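/- **Definitions.** Relation names, variables and constants (data values) are taken from countably infinite sets. A *database* $\mathbf{DB}$ over a finite schema of relation names with arities consists of a finite set of ground atoms (facts) $r(a_1,\dots,a_m)$ that respect the schema, and of a finite universe $U$ that contains all data values occurring in the facts. A *conjunctive query* is a rule $$Q:\quad ans(\mathbf u)\leftarrow r_1(\mathbf u_1)\wedge\dots\wedge r_n(\mathbf u_n),\qquad n\ge 0,$$ where $\mathbf u,\mathbf u_1,\dots,\mathbf u_n$ are finite lists of variables and constants and the lengths of the $\mathbf u_i$ agree with the arities; $Q$ need not be Boolean, that is, $\mathbf u$ may contain variables. $atoms(Q)$ is the set of body atoms, $var(A)$ the set of variables of an atom $A$, $var(R)=\bigcup_{A\in R}var(A)$ for a set $R$ of atoms, and $var(Q)$ the set of variables occurring in $Q$. The *answer* of $Q$ on $\mathbf{DB}$ is the finite relation of all tuples $\mathbf u\theta$ with $\theta:var(Q)\to U$ such that $r_i(\mathbf u_i)\theta\in\mathbf{DB}$ for all $i$. A *hypertree decomposition* of $Q$ is a finite rooted tree $T$ whose vertices $p$ are labelled by sets $\chi(p)\subseteq var(Q)$ and $\lambda(p)\subseteq atoms(Q)$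 such that: 1. for each $A\in atoms(Q)$ there is a vertex $p$ with $var(A)\subseteq\chi(p)$; 2. for each $Y\in var(Q)$, the set of vertices $p$ with $Y\in\chi(p)$ induces a (possibly empty) connected subtree of $T$; 3. $\chi(p)\subseteq var(\lambda(p))$ for each vertex $p$; 4. $var(\lambda(p))\cap\bigcup_{q\in T_p}\chi(q)\subseteq\chi(p)$ for each vertex $p$, where $T_p$ is the subtree rooted at $p$. Its *width* is $\max_p|\lambda(p)|$. The *size* of an instance or a relation is the length of its standard encoding as a word over a fixed finite alphabet (numbers in binary; finite sets written as lists; trees as lists of vertices, parents first, with parent pointers and labels). **Theorem.** Let $k>0$ be a fixed integer. There are a deterministic multi-stack Turing machine $M$ and a polynomial $p$ (both depending only on $k$) such that, for every database $\mathbf{DB}$, every (not necessarily Boolean) conjunctive query $Q$, and every hypertree decomposition $H\!D$ of $Q$ of width at most $k$, the machine $M$, on input $\langle \mathbf{DB},Q,H\!D\rangle$, outputs a list, without repetitions, of exactly the tuples of the answer of $Q$ on $\mathbf{DB}$, and halts within $p(N+S)$ steps, where $N$ is the size of the input $\langle\mathbf{DB},Q,H\!D\rangle$ and $S$ is the size of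 the answer relation. -/

import Mathlib

namespace ConjQuery

/-! ### Databases and conjunctive queries

Relation names, variables and data values (constants) are drawn from countably infinite sets,
each of which is identified with `ℕ`. Finite sets that are part of an input instance are presented
by lists; their meaning depends on membership only, never on order or repetition. -/

/-- A database schema: finitely many relation names, each with its arity. -/
structure Schema where
  names : Finset ℕ
  arity : ℕ → ℕ

/-- A ground atom `r(a₁, …, aₘ)`, i.e. a tuple `⟨a₁, …, aₘ⟩` of the relation `r`. -/
structure Fact where
  rel : ℕ
  args : List ℕ
deriving DecidableEq

/-- A database instance, identified with its set of ground facts, together with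
its finite universe `dom`. -/
structure Database where
  facts : List Fact
  dom : List ℕ

/-- `DB` is a database instance over the schema `S`: every fact belongs to a relation of `S` and
has the right arity, and every data value that occurs in a fact is in the universe. -/
def Database.IsOver (DB : Database) (S : Schema) : Prop :=
  ∀ f ∈ DB.facts, f.rel ∈ S.names ∧ f.args.length = S.arity f.rel ∧
    ∀ a ∈ f.args, a ∈ DB.dom

/-- A term is a variable or a constant. -/
inductive Term where
  | var (x : ℕ)
  | const (c : ℕ)
deriving DecidableEq

/-- The variables occurring in a list of terms. -/
def varsOf (ts : List Term) : Set ℕ := {x | Term.var x ∈ ts}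

/-- The value of a term under a substitution. -/
def Term.subst (θ : ℕ → ℕ) : Term → ℕ
  | .var x => θ x
  | .const c => c

/-- A body atom `r(u)`. -/
structure Atom where
  rel : ℕ
  args : List Term
deriving DecidableEq

/-- `var(A)`. -/
def Atom.vars (A : Atom) : Set ℕ := varsOf A.args

/-- The ground atom `Aθ`. -/
def Atom.subst (θ : ℕ → ℕ) (A : Atom) : Fact := ⟨A.rel, A.args.map (Term.subst θ)⟩

/-- A conjunctive query `ans(u) ← r₁(u₁) ∧ ⋯ ∧ rₙ(uₙ)`: `head` is the list of terms `u`,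
`body` is the list of the atoms `rᵢ(uᵢ)`. -/
structure Query where
  head : List Term
  body : List Atom

/-- `Q` is a query on the schema `S`. -/
def Query.IsOver (Q : Query) (S : Schema) : Prop :=
  ∀ A ∈ Q.body, A.rel ∈ S.names ∧ A.args.length = S.arity A.rel

/-- `atoms(Q)`: the set of atoms in the body. -/
def Query.atoms (Q : Query) : Finset Atom := Q.body.toFinset

/-- `var(Q)`: the variables that occur in `Q`, in its head or in its body. -/
def Query.vars (Q : Query) : Set ℕ := varsOf Q.head ∪ ⋃ A ∈ Q.atoms, A.vars

/-- The answer of `Q` on `DB`: all tuples `uθ` for substitutions `θ : var(Q) → U` that send every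
body atom to a fact of `DB`. (The values of `θ` outside `var(Q)` are irrelevant.) -/
def Query.answer (Q : Query) (DB : Database) : Set (List ℕ) :=
  {t | ∃ θ : ℕ → ℕ, (∀ x ∈ Q.vars, θ x ∈ DB.dom) ∧
    (∀ A ∈ Q.atoms, A.subst θ ∈ DB.facts) ∧ t = Q.head.map (Term.subst θ)}

/-! ### Hypertree decompositions -/

/-- A finite rooted tree, whose vertices `0, …, n` are labelled by a finite set `χ` of variables and
a finite set `λ` of atoms. The root is `0`, and the vertices are listed in such a way that the
parent of every other vertex precedes it (e.g. in preorder); every finite rooted tree can be listed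
like this. By convention the root is stored as its own parent. -/
structure Hypertree where
  n : ℕ
  parent : Fin (n + 1) → Fin (n + 1)
  parent_root : parent 0 = 0
  parent_lt : ∀ p, p ≠ 0 → parent p < p
  chiList : Fin (n + 1) → List ℕ
  lamList : Fin (n + 1) → List Atom

namespace Hypertree

variable (H : Hypertree)

/-- The vertices of the tree. -/
abbrev Vertex : Type := Fin (H.n + 1)

/-- `χ(p)`. -/
def chi (p : H.Vertex) : Finset ℕ := (H.chiList p).toFinset

/-- `λ(p)`. -/
def lam (p : H.Vertex) : Finset Atom := (H.lamList p).toFinset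

/-- `var(λ(p))`. -/
def lamVars (p : H.Vertex) : Set ℕ := ⋃ A ∈ H.lam p, A.vars

/-- The tree as an undirected graph: the edges join every non-root vertex with its parent. -/
def graph : SimpleGraph H.Vertex :=
  SimpleGraph.fromRel fun p q => H.parent p = q

/-- The vertices of the subtree `T_p` rooted at `p`: all `q` that have `p` as an ancestor
(`p` itself included). -/
def subtree (p : H.Vertex) : Set H.Vertex := {q | ∃ m : ℕ, H.parent^[m] q = p}

/-- The width `max_p |λ(p)|`. -/
def width : ℕ := Finset.univ.sup fun p => (H.lam p).card

/-- `H` is a hypertree for the query `Q`. -/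
def IsHypertreeFor (Q : Query) : Prop :=
  ∀ p, (∀ x ∈ H.chi p, x ∈ Q.vars) ∧ H.lam p ⊆ Q.atoms

/-- `H` is a hypertree decomposition of the query `Q`. -/
structure IsDecomposition (Q : Query) : Prop where
  isHypertree : H.IsHypertreeFor Q
  covers : ∀ A ∈ Q.atoms, ∃ p, A.vars ⊆ H.chi p
  connected : ∀ x ∈ Q.vars, (H.graph.induce {p | x ∈ H.chi p}).Preconnected
  chi_subset : ∀ p, (H.chi p : Set ℕ) ⊆ H.lamVars p
  special : ∀ p, H.lamVars p ∩ (⋃ q ∈ H.subtree p, (H.chi q : Set ℕ)) ⊆ H.chi p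

end Hypertree

/-! ### Encoding over the alphabet `Computability.Γ'` = {blank, 0, 1, bra, ket, comma}

Numbers are written in binary; lists (and records, as lists of their components) are written with
brackets, every component being followed by a comma. -/

/-- The word `[w₁,w₂,…,wₘ,]`. -/
def bracket (ws : List (List Computability.Γ')) : List Computability.Γ' :=
  Computability.Γ'.bra :: (ws.flatMap (fun w => w ++ [Computability.Γ'.comma]) ++
    [Computability.Γ'.ket])

/-- Binary notation. -/
def encodeNumber (n : ℕ) : List Computability.Γ' := (Computability.encodeNat n).map Computability.Γ'.bit

/-- Tuples of numbers. -/
def encodeNums (l : List ℕ) : List Computability.Γ' := bracket (l.map encodeNumber)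

/-- Terms, with a leading tag bit. -/
def encodeTerm : Term → List Computability.Γ'
  | .var x => Computability.Γ'.bit false :: encodeNumber x
  | .const c => Computability.Γ'.bit true :: encodeNumber c

/-- Lists of terms. -/
def encodeTerms (l : List Term) : List Computability.Γ' := bracket (l.map encodeTerm)

/-- Facts. -/
def encodeFact (f : Fact) : List Computability.Γ' := bracket [encodeNumber f.rel, encodeNums f.args]

/-- Atoms. -/
def encodeAtom (A : Atom) : List Computability.Γ' := bracket [encodeNumber A.rel, encodeTerms A.args]

/-- Lists of atoms. -/
def encodeAtoms (l : List Atom) : List Computability.Γ' := bracket (l.map encodeAtom)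

/-- Databases. -/
def encodeDatabase (DB : Database) : List Computability.Γ' :=
  bracket [bracket (DB.facts.map encodeFact), encodeNums DB.dom]

/-- Queries. -/
def encodeQuery (Q : Query) : List Computability.Γ' :=
  bracket [encodeTerms Q.head, encodeAtoms Q.body]

/-- Hypertrees: the list of the vertices `0, …, n`, each with its parent and its two labels. -/
def encodeHypertree (H : Hypertree) : List Computability.Γ' :=
  bracket (List.ofFn fun p : Fin (H.n + 1) =>
    bracket [encodeNumber (H.parent p : ℕ), encodeNums (H.chiList p), encodeAtoms (H.lamList p)])

/-- The input word for the instance `⟨DB, Q, H⟩`; its length is the size of the instance. -/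
def encodeInput (DB : Database) (Q : Query) (H : Hypertree) : List Computability.Γ' :=
  bracket [encodeDatabase DB, encodeQuery Q, encodeHypertree H]

/-- Relations, as lists of tuples. For a list without repetitions, the length of this word is the
size of the relation, whatever the order in which its tuples are listed. -/
def encodeRelation (R : List (List ℕ)) : List Computability.Γ' := bracket (R.map encodeNums)

/-- The list `L` enumerates the relation `R`, without repetitions. -/
def Enumerates (L : List (List ℕ)) (R : Set (List ℕ)) : Prop :=
  L.Nodup ∧ ∀ t, t ∈ L ↔ t ∈ R

end ConjQuery

/-! The answer is computed by a search without dead ends. The head terms receive values one after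
the other, and a partial assignment σ is kept only if some substitution that satisfies σ sends every
body atom to a fact. If the universe is nonempty, every σ that is kept extends to the whole head,
and different ones extend differently; if it is empty, there is never more than one σ. So an
intermediate list is longer than the answer by at most one (`length_evaluations_le`), and the search
is polynomial in N + S as soon as the test for one σ is polynomial.

The test (`satisfiable`) works on the decomposition. The relation of a vertex p consists of the
matchings of the at most k atoms of λ(p) with facts, restricted to χ(p), that are consistent with σ
and with each body atom taken alone; their number is polynomial because k is fixed. Parents precede
children in the list of vertices, so one pass of semijoins from the last vertex to the first,
against all later vertices and not only the children, leaves to each remaining tuple a partner at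
each child. A genuine solution survives every filter (`satisfiable_of_solves`). Conversely, if no
relation becomes empty, tuples can be chosen from the root downwards that agree along the edges. By
connectedness they agree on every common variable and glue to one θ, and at a vertex that covers an
atom A the filter for A shows that Aθ is a fact (`exists_solves_of_satisfiable`).

For the time bound, structured programs over five stacks are compiled to Turing machines, and the
functions that they compute in polynomial time (`PT`) are closed under composition, case distinction
and folds with bounded intermediate values. Time is measured in a weight that may exceed the size of
the representation. The weight of an `Input` includes S, although the program sees only the input
word; this makes output-polynomial time an instance of `PT`. -/

namespace StackProgram

/-! ### Structured stack programs and their compilation to multi-stack Turing machines -/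

abbrev Sym : Type := Computability.Γ'

/-- The five stacks of the machines below. -/
inductive Reg where
  | main | a | b | c | r
deriving DecidableEq

instance : Fintype Reg := ⟨{.main, .a, .b, .c, .r}, fun x => by cases x <;> decide⟩

abbrev Stacks : Type := Reg → List Sym

/-- Structured programs over stacks. `case k f` pops the stack `k` and continues with the program
that `f` assigns to the popped symbol; `loop k f` pops `k` and runs `f a` on the popped symbol `a`,
until `k` is found empty. -/
inductive Prog : Type where
  | skip : Prog
  | push (k : Reg) (a : Sym) : Prog
  | seq (p q : Prog) : Prog
  | case (k : Reg) (f : Option Sym → Prog) : Prog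
  | loop (k : Reg) (f : Sym → Prog) : Prog

/-- `Exec p S S' t`: started on the stacks `S`, the program `p` ends with the stacks `S'` after
`t` steps. -/
inductive Exec : Prog → Stacks → Stacks → ℕ → Prop where
  | skip (S : Stacks) : Exec .skip S S 1
  | push (k : Reg) (a : Sym) (S : Stacks) :
      Exec (.push k a) S (Function.update S k (a :: S k)) 1
  | seq {p q : Prog} {S S' S'' : Stacks} {t t' : ℕ} :
      Exec p S S' t → Exec q S' S'' t' → Exec (.seq p q) S S'' (t + t')
  | case {k : Reg} {f : Option Sym → Prog} {S S' : Stacks} {t : ℕ} :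
      Exec (f (S k).head?) (Function.update S k (S k).tail) S' t →
      Exec (.case k f) S S' (1 + t)
  | loop_nil {k : Reg} (f : Sym → Prog) {S : Stacks} :
      S k = [] → Exec (.loop k f) S S 1
  | loop_cons {k : Reg} {f : Sym → Prog} {S S' S'' : Stacks} {x : Sym} {l : List Sym} {t t' : ℕ} :
      S k = x :: l → Exec (f x) (Function.update S k l) S' t → Exec (.loop k f) S' S'' t' →
      Exec (.loop k f) S S'' (1 + (t + t'))

/-- The control points inside a program. -/
def Prog.Label : Prog → Type
  | .skip => Unit
  | .push _ _ => Unit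
  | .seq p q => p.Label ⊕ q.Label
  | .case _ f => Option (Σ o, (f o).Label)
  | .loop _ f => Option (Σ x, (f x).Label)

@[reducible]
noncomputable def Prog.labelFintype : (p : Prog) → Fintype p.Label
  | .skip => inferInstanceAs (Fintype Unit)
  | .push _ _ => inferInstanceAs (Fintype Unit)
  | .seq p q =>
    letI := p.labelFintype
    letI := q.labelFintype
    inferInstanceAs (Fintype (p.Label ⊕ q.Label))
  | .case _ f =>
    letI := fun o => (f o).labelFintype
    inferInstanceAs (Fintype (Option (Σ o, (f o).Label)))
  | .loop _ f =>
    letI := fun o => (f o).labelFintype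
    inferInstanceAs (Fintype (Option (Σ o, (f o).Label)))

/-- The control point at which the execution of a program starts. -/
def Prog.start : (p : Prog) → p.Label
  | .skip => ()
  | .push _ _ => ()
  | .seq p _ => .inl p.start
  | .case _ _ => none
  | .loop _ _ => none

open Turing in
/-- The code at the control points of a program that is embedded into a larger machine by `e` and
continues at `x` when it has ended. -/
def Prog.code {Λ : Type} : (p : Prog) → (p.Label → Λ) → Λ → p.Label →
    TM2.Stmt (fun _ : Reg => Sym) Λ (Option Sym)
  | .skip, _, x, _ => TM2.Stmt.goto fun _ => x
  | .push k a, _, x, _ => TM2.Stmt.push k (fun _ => a) (TM2.Stmt.goto fun _ => x)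
  | .seq p q, e, x, l =>
    match l with
    | .inl l => p.code (fun l => e (.inl l)) (e (.inr q.start)) l
    | .inr l => q.code (fun l => e (.inr l)) x l
  | .case k f, e, x, l =>
    match l with
    | none => TM2.Stmt.pop k (fun _ o => o) (TM2.Stmt.goto fun o => e (some ⟨o, (f o).start⟩))
    | some ⟨o, l⟩ => (f o).code (fun l => e (some ⟨o, l⟩)) x l
  | .loop k f, e, x, l =>
    match l with
    | none => TM2.Stmt.pop k (fun _ o => o)
        (TM2.Stmt.goto fun o => o.elim x fun a => e (some ⟨a, (f a).start⟩))
    | some ⟨a, l⟩ => (f a).code (fun l => e (some ⟨a, l⟩)) (e none) l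

-- The internal state `v` is arbitrary because it is read only right after a pop, which overwrites
-- it. The embedding `e` and the exit `x` are general so that the induction applies to subprograms
-- in place.
open Turing in
theorem Exec.reaches {Λ : Type} (m : Λ → TM2.Stmt (fun _ : Reg => Sym) Λ (Option Sym))
    {p : Prog} {S S' : Stacks} {t : ℕ} (h : Exec p S S' t) :
    ∀ (e : p.Label → Λ) (x : Λ), (∀ l, m (e l) = p.code e x l) → ∀ v, ∃ v',
      (flip bind (TM2.step m))^[t] (some ⟨some (e p.start), v, S⟩) = some ⟨some x, v', S'⟩ := by
  induction h with
  | skip S =>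
    intro e x he v
    have h₀ : m (e Prog.skip.start) = TM2.Stmt.goto fun _ => x := he _
    exact ⟨v, by simp [flip, h₀]⟩
  | push k a S =>
    intro e x he v
    have h₀ : m (e (Prog.push k a).start) =
      TM2.Stmt.push k (fun _ => a) (TM2.Stmt.goto fun _ => x) := he _
    exact ⟨v, by simp [flip, h₀]⟩
  | @seq p q S S' S'' t t' _ _ ih₁ ih₂ =>
    intro e x he v
    obtain ⟨v₁, h₁⟩ := ih₁ (fun l => e (.inl l)) (e (.inr q.start)) (fun l => he (.inl l)) v
    obtain ⟨v₂, h₂⟩ := ih₂ (fun l => e (.inr l)) x (fun l => he (.inr l)) v₁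
    refine ⟨v₂, ?_⟩
    rw [Nat.add_comm, Function.iterate_add_apply]
    simp only [Prog.start]
    rw [h₁, h₂]
  | @case k f S S' t _ ih =>
    intro e x he v
    obtain ⟨v₁, h₁⟩ := ih (fun l => e (some ⟨_, l⟩)) x (fun l => he (some ⟨_, l⟩)) (S k).head?
    refine ⟨v₁, ?_⟩
    have h₀ : m (e (Prog.case k f).start) = TM2.Stmt.pop k (fun _ o => o)
      (TM2.Stmt.goto fun o => e (some ⟨o, (f o).start⟩)) := he _
    rw [Nat.add_comm, Function.iterate_add_apply, ← h₁]
    simp [flip, h₀]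
  | @loop_nil k f S hS =>
    intro e x he v
    refine ⟨none, ?_⟩
    have : Function.update S k [] = S := by rw [← hS, Function.update_eq_self]
    have h₀ : m (e (Prog.loop k f).start) = TM2.Stmt.pop k (fun _ o => o)
      (TM2.Stmt.goto fun o => o.elim x fun a => e (some ⟨a, (f a).start⟩)) := he _
    simp [flip, h₀, hS, this]
  | @loop_cons k f S S' S'' a l t t' hS _ _ ih₁ ih₂ =>
    intro e x he v
    obtain ⟨v₁, h₁⟩ := ih₁ (fun l => e (some ⟨a, l⟩)) (e none) (fun l => he (some ⟨_, l⟩)) (some a)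
    obtain ⟨v₂, h₂⟩ := ih₂ e x he v₁
    have h₀ : m (e (Prog.loop k f).start) = TM2.Stmt.pop k (fun _ o => o)
      (TM2.Stmt.goto fun o => o.elim x fun a => e (some ⟨a, (f a).start⟩)) := he _
    refine ⟨v₂, ?_⟩
    rw [Nat.add_comm, Function.iterate_add_apply, Nat.add_comm t t', Function.iterate_add_apply,
      ← h₂]
    refine congrArg _ (Eq.trans ?_ h₁)
    simp [flip, h₀, hS]

open Turing TM2.Stmt in
/-- The machine that runs a program, with input on stack `a` and output on stack `b`. -/
noncomputable def Prog.toFinTM2 (p : Prog) : FinTM2 where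
  K := Reg
  k₀ := .a
  k₁ := .b
  Γ _ := Sym
  Λ := Option p.Label
  main := some p.start
  ΛFin := letI := p.labelFintype; inferInstance
  σ := Option Sym
  initialState := none
  -- The exit label resets the internal state before halting, since a halting configuration must
  -- carry the initial state. This is the one extra step in `Exec.outputsInTime`.
  m l := l.elim (load (fun _ => none) halt) (p.code some none)

open Turing in
theorem Exec.outputsInTime {p : Prog} {x y : List Sym} {t n : ℕ}
    (h : Exec p (fun k : Reg => if k = .a then x else []) (fun k : Reg => if k = .b then y else []) t)
    (hn : t + 1 ≤ n) : Nonempty (TM2OutputsInTime p.toFinTM2 x (some y) n) := by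
  obtain ⟨v, hv⟩ := h.reaches (Λ := Option p.Label) p.toFinTM2.m some none (fun _ => rfl) none
  refine ⟨⟨⟨t + 1, ?_⟩, hn⟩⟩
  rw [Nat.add_comm, Function.iterate_add_apply]
  have h₀ : initList p.toFinTM2 x =
      (⟨some (some p.start), none, fun k : Reg => if k = .a then x else []⟩ :
      TM2.Cfg (fun _ : Reg => Sym) (Option p.Label) (Option Sym)) := by
    unfold initList
    congr 1
  have h₁ : haltList p.toFinTM2 y = (⟨none, none, fun k : Reg => if k = .b then y else []⟩ :
      TM2.Cfg (fun _ : Reg => Sym) (Option p.Label) (Option Sym)) := by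
    unfold haltList
    congr 1
  change _ = some (haltList p.toFinTM2 y)
  rw [h₀, h₁]
  refine (congrArg _ hv).trans ?_
  rfl

end StackProgram

/-! ### Step bounds, prefix codes of binary trees, and tree operations on stacks -/

namespace StackProgram

/-- `p` leads from the stacks `S` to the stacks `S'` in at most `n` steps. -/
def Runs (p : Prog) (S S' : Stacks) (n : ℕ) : Prop := ∃ t ≤ n, Exec p S S' t

theorem Runs.mono {p : Prog} {S S' : Stacks} {n n' : ℕ} (h : Runs p S S' n) (hn : n ≤ n') :
    Runs p S S' n' := by
  obtain ⟨t, ht, h⟩ := h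
  exact ⟨t, ht.trans hn, h⟩

theorem Runs.skip (S : Stacks) : Runs .skip S S 1 := ⟨1, le_rfl, .skip S⟩

theorem Runs.push (k : Reg) (a : Sym) (S : Stacks) :
    Runs (.push k a) S (Function.update S k (a :: S k)) 1 := ⟨1, le_rfl, .push k a S⟩

theorem Runs.seq {p q : Prog} {S S' S'' : Stacks} {n n' : ℕ} (h : Runs p S S' n)
    (h' : Runs q S' S'' n') : Runs (.seq p q) S S'' (n + n') := by
  obtain ⟨t, ht, h⟩ := h
  obtain ⟨t', ht', h'⟩ := h'
  exact ⟨t + t', by lia, h.seq h'⟩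

theorem Runs.case {k : Reg} {f : Option Sym → Prog} {S S' : Stacks} {n : ℕ}
    (h : Runs (f (S k).head?) (Function.update S k (S k).tail) S' n) :
    Runs (.case k f) S S' (1 + n) := by
  obtain ⟨t, ht, h⟩ := h
  exact ⟨1 + t, by lia, h.case⟩

theorem Runs.loop_nil {k : Reg} (f : Sym → Prog) {S : Stacks} (h : S k = []) :
    Runs (.loop k f) S S 1 := ⟨1, le_rfl, .loop_nil f h⟩

theorem Runs.loop_cons {k : Reg} {f : Sym → Prog} {S S' S'' : Stacks} {x : Sym} {l : List Sym}
    {n n' : ℕ} (hS : S k = x :: l) (h : Runs (f x) (Function.update S k l) S' n)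
    (h' : Runs (.loop k f) S' S'' n') : Runs (.loop k f) S S'' (1 + (n + n')) := by
  obtain ⟨t, ht, h⟩ := h
  obtain ⟨t', ht', h'⟩ := h'
  exact ⟨1 + (t + t'), by lia, .loop_cons hS h h'⟩

/-- The stacks with the given contents. -/
def mk (m a b c r : List Sym) : Stacks
  | .main => m
  | .a => a
  | .b => b
  | .c => c
  | .r => r

section mk

variable (m a b c r l : List Sym)

@[simp] theorem mk_main : mk m a b c r .main = m := rfl
@[simp] theorem mk_a : mk m a b c r .a = a := rfl
@[simp] theorem mk_b : mk m a b c r .b = b := rfl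
@[simp] theorem mk_c : mk m a b c r .c = c := rfl
@[simp] theorem mk_r : mk m a b c r .r = r := rfl

@[simp] theorem update_mk_main : Function.update (mk m a b c r) .main l = mk l a b c r := by
  funext k; cases k <;> rfl

@[simp] theorem update_mk_a : Function.update (mk m a b c r) .a l = mk m l b c r := by
  funext k; cases k <;> rfl

@[simp] theorem update_mk_b : Function.update (mk m a b c r) .b l = mk m a l c r := by
  funext k; cases k <;> rfl

@[simp] theorem update_mk_c : Function.update (mk m a b c r) .c l = mk m a b l r := by
  funext k; cases k <;> rfl

@[simp] theorem update_mk_r : Function.update (mk m a b c r) .r l = mk m a b c l := by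
  funext k; cases k <;> rfl

end mk

/-- Binary trees, the data manipulated by the programs. -/
inductive Data where
  | nil
  | node (x y : Data)
deriving DecidableEq

abbrev zero : Sym := .bit false

abbrev one : Sym := .bit true

/-- The prefix code of a tree. -/
def Data.code : Data → List Sym
  | .nil => [zero]
  | .node x y => one :: (x.code ++ y.code)

def Data.size : Data → ℕ
  | .nil => 1
  | .node x y => x.size + y.size + 1

@[simp] theorem Data.length_code (x : Data) : x.code.length = x.size := by
  induction x with
  | nil => rfl
  | node x y ihx ihy => simp [code, size, ihx, ihy]

/-- The code is prefix-free, so trees can lie on a stack without separators, and comparing codes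
compares trees. -/
theorem Data.code_append_inj {x y : Data} {u v : List Sym} (h : x.code ++ u = y.code ++ v) :
    x = y ∧ u = v := by
  induction x generalizing y u v with
  | nil => cases y <;> simp_all [code]
  | node x₁ x₂ ih₁ ih₂ =>
    cases y with
    | nil => simp [code] at h
    | node y₁ y₂ =>
      simp only [code, List.cons_append, List.cons.injEq, true_and, List.append_assoc] at h
      obtain ⟨h₁, h'⟩ := ih₁ h
      obtain ⟨h₂, h''⟩ := ih₂ h'
      exact ⟨by rw [h₁, h₂], h''⟩

/-- Moves the tree on top of `k` to the stack `a`, in reverse. -/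
def grab (k : Reg) : Prog :=
  -- Stack `c` counts in unary the trees still to be read: a leaf uses up one mark, a node uses up
  -- one and adds two.
  .seq (.push .c one) (.loop .c fun _ => .case k fun o =>
    if o = some one then .seq (.push .a one) (.seq (.push .c one) (.push .c one))
    else .push .a zero)

/-- Stated with a continuation: the run of the loop after `x` has been read is a hypothesis, so that
the induction can chain the two subtrees of a node. -/
theorem grab_main_loop (x : Data) : ∀ {m a b c r : List Sym} {S : Stacks} {n : ℕ},
    Runs (.loop .c fun _ => .case .main fun o =>
      if o = some one then .seq (.push .a one) (.seq (.push .c one) (.push .c one))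
      else .push .a zero) (mk m (x.code.reverse ++ a) b c r) S n →
    Runs (.loop .c fun _ => .case .main fun o =>
      if o = some one then .seq (.push .a one) (.seq (.push .c one) (.push .c one))
      else .push .a zero) (mk (x.code ++ m) a b (one :: c) r) S (5 * x.size + n) := by
  induction x with
  | nil =>
    intro m a b c r S n h
    refine (Runs.loop_cons rfl (.case ?_) h).mono (n := 1 + (1 + 1 + n)) (by simp [Data.size]; lia)
    simpa [Data.code] using Runs.push .a zero (mk m a b c r)
  | node x y ihx ihy =>
    intro m a b c r S n h
    have h₁ := ihx (m := y.code ++ m) (a := one :: a) (b := b) (c := one :: c) (r := r)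
      (ihy (by simpa [Data.code] using h))
    refine (Runs.loop_cons rfl (.case ?_) h₁).mono
      (n := 1 + (1 + 3 + (5 * x.size + (5 * y.size + n)))) (by simp [Data.size]; lia)
    have h₂ := (Runs.push .a one (mk (x.code ++ (y.code ++ m)) a b c r)).seq
      ((Runs.push .c one _).seq (Runs.push .c one _))
    simpa [Data.code] using h₂

theorem grab_r_loop (x : Data) : ∀ {m a b c r : List Sym} {S : Stacks} {n : ℕ},
    Runs (.loop .c fun _ => .case .r fun o =>
      if o = some one then .seq (.push .a one) (.seq (.push .c one) (.push .c one))
      else .push .a zero) (mk m (x.code.reverse ++ a) b c r) S n →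
    Runs (.loop .c fun _ => .case .r fun o =>
      if o = some one then .seq (.push .a one) (.seq (.push .c one) (.push .c one))
      else .push .a zero) (mk m a b (one :: c) (x.code ++ r)) S (5 * x.size + n) := by
  induction x with
  | nil =>
    intro m a b c r S n h
    refine (Runs.loop_cons rfl (.case ?_) h).mono (n := 1 + (1 + 1 + n)) (by simp [Data.size]; lia)
    simpa [Data.code] using Runs.push .a zero (mk m a b c r)
  | node x y ihx ihy =>
    intro m a b c r S n h
    have h₁ := ihx (m := m) (a := one :: a) (b := b) (c := one :: c) (r := y.code ++ r)
      (ihy (by simpa [Data.code] using h))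
    refine (Runs.loop_cons rfl (.case ?_) h₁).mono
      (n := 1 + (1 + 3 + (5 * x.size + (5 * y.size + n)))) (by simp [Data.size]; lia)
    have h₂ := (Runs.push .a one (mk m a b c (x.code ++ (y.code ++ r)))).seq
      ((Runs.push .c one _).seq (Runs.push .c one _))
    simpa [Data.code] using h₂

theorem runs_grab_main (x : Data) (m b r : List Sym) :
    Runs (grab .main) (mk (x.code ++ m) [] b [] r) (mk m x.code.reverse b [] r)
      (5 * x.size + 2) := by
  have h := grab_main_loop x (m := m) (a := []) (b := b) (c := []) (r := r)
    (Runs.loop_nil _ rfl)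
  refine ((Runs.push .c one _).seq (by simpa using h)).mono (by lia)

theorem runs_grab_r (x : Data) (m b r : List Sym) :
    Runs (grab .r) (mk m [] b [] (x.code ++ r)) (mk m x.code.reverse b [] r)
      (5 * x.size + 2) := by
  have h := grab_r_loop x (m := m) (a := []) (b := b) (c := []) (r := r)
    (Runs.loop_nil _ rfl)
  refine ((Runs.push .c one _).seq (by simpa using h)).mono (by lia)

/-- Moves the contents of stack `k` to stack `k'`, in reverse. -/
def pour (k k' : Reg) : Prog := .loop k fun x => .push k' x

theorem runs_pour {k k' : Reg} (hk : k ≠ k') (S : Stacks) :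
    Runs (pour k k') S
      (Function.update (Function.update S k []) k' ((S k).reverse ++ S k'))
      (2 * (S k).length + 1) := by
  generalize hw : S k = w
  induction w generalizing S with
  | nil =>
    have hS : Function.update S k [] = S := by rw [← hw, Function.update_eq_self]
    simpa [hS, pour] using Runs.loop_nil _ hw
  | cons x w ih =>
    have h := ih (Function.update (Function.update S k w) k' (x :: S k'))
      (by simp [Function.update_of_ne hk])
    refine (Runs.loop_cons hw (.push k' x _) ?_).mono (n := 1 + (1 + (2 * w.length + 1)))
      (by simp; lia)
    rw [Function.update_of_ne hk.symm]
    convert h using 1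
    · rfl
    funext j
    by_cases h₁ : j = k <;> by_cases h₂ : j = k' <;> simp_all

/-- Empties stack `k`. -/
def drain (k : Reg) : Prog := .loop k fun _ => .skip

theorem runs_drain (k : Reg) (S : Stacks) :
    Runs (drain k) S (Function.update S k []) (2 * (S k).length + 1) := by
  generalize hw : S k = w
  induction w generalizing S with
  | nil =>
    have hS : Function.update S k [] = S := by rw [← hw, Function.update_eq_self]
    simpa [hS, drain] using Runs.loop_nil _ hw
  | cons x w ih =>
    have h := ih (Function.update S k w) (by simp)
    rw [Function.update_idem] at h
    exact (Runs.loop_cons hw (.skip _) h).mono (by simp; lia)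

/-- The stacks between two operations on trees: only `main` and `r` are in use. -/
def st (m r : List Sym) : Stacks := mk m [] [] [] r

def opDrop : Prog := .seq (grab .main) (drain .a)

theorem runs_drop (x : Data) (m r : List Sym) :
    Runs opDrop (st (x.code ++ m) r) (st m r) (7 * x.size + 3) := by
  refine ((runs_grab_main x m [] r).seq ?_).mono (n := 5 * x.size + 2 + (2 * x.size + 1)) (by lia)
  simpa [st] using runs_drain .a (mk m x.code.reverse [] [] r)

def opToR : Prog := .seq (grab .main) (pour .a .r)

theorem runs_toR (x : Data) (m r : List Sym) :
    Runs opToR (st (x.code ++ m) r) (st m (x.code ++ r)) (7 * x.size + 3) := by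
  refine ((runs_grab_main x m [] r).seq ?_).mono (n := 5 * x.size + 2 + (2 * x.size + 1)) (by lia)
  simpa [st] using runs_pour (k := .a) (k' := .r) (by simp) (mk m x.code.reverse [] [] r)

def opFromR : Prog := .seq (grab .r) (pour .a .main)

theorem runs_fromR (x : Data) (m r : List Sym) :
    Runs opFromR (st m (x.code ++ r)) (st (x.code ++ m) r) (7 * x.size + 3) := by
  refine ((runs_grab_r x m [] r).seq ?_).mono (n := 5 * x.size + 2 + (2 * x.size + 1)) (by lia)
  simpa [st] using runs_pour (k := .a) (k' := .main) (by simp) (mk m x.code.reverse [] [] r)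

/-- The first tree waits on `b`, because `grab` needs `a` and `c` for the second one. Every pour
reverses, hence the detour through `c`. -/
def opSwap : Prog :=
  .seq (grab .main) <| .seq (pour .a .b) <| .seq (grab .main) <| .seq (pour .b .c) <|
    .seq (pour .c .main) (pour .a .main)

theorem runs_swap (x y : Data) (m r : List Sym) :
    Runs opSwap (st (x.code ++ (y.code ++ m)) r) (st (y.code ++ (x.code ++ m)) r)
      (11 * (x.size + y.size) + 8) := by
  have h₁ := runs_grab_main x (y.code ++ m) [] r
  have h₂ := runs_pour (k := .a) (k' := .b) (by simp) (mk (y.code ++ m) x.code.reverse [] [] r)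
  have h₃ := runs_grab_main y m x.code r
  have h₄ := runs_pour (k := .b) (k' := .c) (by simp) (mk m y.code.reverse x.code [] r)
  have h₅ := runs_pour (k := .c) (k' := .main) (by simp) (mk m y.code.reverse [] x.code.reverse r)
  have h₆ := runs_pour (k := .a) (k' := .main) (by simp) (mk (x.code ++ m) y.code.reverse [] [] r)
  simp only [update_mk_main, update_mk_a, update_mk_b, update_mk_c, mk_main, mk_a, mk_b, mk_c,
    List.reverse_reverse, List.append_nil, List.length_reverse, Data.length_code] at h₁ h₂ h₃ h₄ h₅ h₆
  exact (h₁.seq (h₂.seq (h₃.seq (h₄.seq (h₅.seq h₆))))).mono (by lia)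

def opDup : Prog :=
  .seq (grab .main) <| .seq (.loop .a fun x => .seq (.push .main x) (.push .b x)) <|
    .seq (pour .b .a) (pour .a .main)

theorem runs_dup_loop (w m b c r : List Sym) :
    Runs (.loop .a fun x => .seq (.push .main x) (.push .b x)) (mk m w b c r)
      (mk (w.reverse ++ m) [] (w.reverse ++ b) c r) (3 * w.length + 1) := by
  induction w generalizing m b with
  | nil => exact .loop_nil _ rfl
  | cons x w ih =>
    refine (Runs.loop_cons rfl ((Runs.push .main x _).seq (Runs.push .b x _))
      (n' := 3 * w.length + 1) ?_).mono (by simp; lia)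
    simpa using ih (x :: m) (x :: b)

theorem runs_dup (x : Data) (m r : List Sym) :
    Runs opDup (st (x.code ++ m) r) (st (x.code ++ (x.code ++ m)) r) (12 * x.size + 5) := by
  have h₁ := runs_grab_main x m [] r
  have h₂ := runs_dup_loop x.code.reverse m [] [] r
  have h₃ := runs_pour (k := .b) (k' := .a) (by simp) (mk (x.code ++ m) [] x.code [] r)
  have h₄ := runs_pour (k := .a) (k' := .main) (by simp) (mk (x.code ++ m) x.code.reverse [] [] r)
  simp only [update_mk_main, update_mk_a, update_mk_b, mk_main, mk_a, mk_b,
    List.reverse_reverse, List.append_nil, List.length_reverse, Data.length_code] at h₁ h₂ h₃ h₄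
  exact (h₁.seq (h₂.seq (h₃.seq h₄))).mono (by lia)

def opNil : Prog := .push .main zero

theorem runs_nil (m r : List Sym) : Runs opNil (st m r) (st (Data.nil.code ++ m) r) 1 := by
  simpa [st, Data.code, opNil] using Runs.push .main zero (st m r)

def opCons : Prog := .push .main one

theorem runs_cons (x y : Data) (m r : List Sym) :
    Runs opCons (st (x.code ++ (y.code ++ m)) r) (st ((Data.node x y).code ++ m) r) 1 := by
  simpa [st, Data.code, opCons] using Runs.push .main one (st (x.code ++ (y.code ++ m)) r)

/-- Removes a leaf from the top and runs `p`, or replaces a node by its children and runs `q`. -/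
def opCase (p q : Prog) : Prog := .case .main fun o => if o = some one then q else p

theorem runs_case_nil {p q : Prog} {m r : List Sym} {S : Stacks} {n : ℕ}
    (h : Runs p (st m r) S n) : Runs (opCase p q) (st (Data.nil.code ++ m) r) S (1 + n) :=
  .case (by simpa [st, Data.code] using h)

theorem runs_case_node {p q : Prog} {x y : Data} {m r : List Sym} {S : Stacks} {n : ℕ}
    (h : Runs q (st (x.code ++ (y.code ++ m)) r) S n) :
    Runs (opCase p q) (st ((Data.node x y).code ++ m) r) S (1 + n) :=
  .case (by simpa [st, Data.code] using h)

/-- The mark on `c` keeps the loop alive. It is popped before `p` runs and pushed back afterwards,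
so `p` finds `c` empty and may use it. -/
def whileBody (p : Prog) : Prog :=
  .loop .c fun _ => .case .main fun o => if o = some one then .seq p (.push .c one) else .skip

/-- As long as the top is a node, replaces it by its children and runs `p`; finally removes the
leaf. -/
def opWhile (p : Prog) : Prog := .seq (.push .c one) (whileBody p)

theorem runs_whileBody_nil (p : Prog) (m r : List Sym) :
    Runs (whileBody p) (mk (Data.nil.code ++ m) [] [] [one] r) (st m r) 4 := by
  refine (Runs.loop_cons (n := 2) (n' := 1) rfl (.case (S' := st m r) (n := 1) ?_)
    (.loop_nil _ rfl)).mono (by lia)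
  simpa [st, Data.code] using Runs.skip (st m r)

theorem runs_whileBody_node {p : Prog} {x y : Data} {m m' r r' : List Sym} {S : Stacks} {n n' : ℕ}
    (h : Runs p (st (x.code ++ (y.code ++ m)) r) (st m' r') n)
    (h' : Runs (whileBody p) (mk m' [] [] [one] r') S n') :
    Runs (whileBody p) (mk ((Data.node x y).code ++ m) [] [] [one] r) S (n + 3 + n') := by
  refine (Runs.loop_cons (n := 1 + (n + 1)) rfl (.case ?_) h').mono (by lia)
  have h₁ := h.seq (Runs.push .c one _)
  simpa [st, Data.code] using h₁

theorem runs_while {p : Prog} {m r : List Sym} {S : Stacks} {n : ℕ}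
    (h : Runs (whileBody p) (mk m [] [] [one] r) S n) : Runs (opWhile p) (st m r) S (1 + n) :=
  (Runs.push .c one _).seq (by simpa [st] using h)

def eqLoop : Prog :=
  .loop .b fun x => .case .c fun o => if o = some x then .skip else .push .a one

/-- Every mismatch leaves a mark on `a`. The loop detects only prefixes, which for codes of trees is
the same as equality. -/
theorem runs_eqLoop (m r w : List Sym) : ∀ a c : List Sym, ∃ a' c' : List Sym,
    Runs eqLoop (mk m a w c r) (mk m a' [] c' r) (3 * w.length + 1) ∧
      (a' = [] ↔ a = [] ∧ w <+: c) ∧ a'.length ≤ a.length + w.length ∧ c'.length ≤ c.length := by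
  induction w with
  | nil => exact fun a c => ⟨a, c, .loop_nil _ rfl, by simp, by simp, le_rfl⟩
  | cons x w ih =>
    intro a c
    by_cases hc : c.head? = some x
    · obtain ⟨c, rfl⟩ : ∃ c', c = x :: c' := by cases c <;> simp_all
      obtain ⟨a', c', h₁, h₂, h₃, h₄⟩ := ih a c
      refine ⟨a', c', (Runs.loop_cons (n := 2) rfl (.case (S' := mk m a w c r) (n := 1) ?_)
        h₁).mono (by simp; lia), by simp [h₂], by simp; lia, by simp; lia⟩
      simpa using Runs.skip (mk m a w c r)
    · obtain ⟨a', c', h₁, h₂, h₃, h₄⟩ := ih (one :: a) c.tail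
      refine ⟨a', c', (Runs.loop_cons (n := 2) rfl
        (.case (S' := mk m (one :: a) w c.tail r) (n := 1) ?_) h₁).mono (by simp; lia), ?_,
        by simp at h₃ ⊢; lia, by simp at h₄ ⊢; lia⟩
      · simpa [hc] using Runs.push .a one (mk m a w c.tail r)
      · simp only [h₂]
        cases c with
        | nil => simp
        | cons y c =>
          have : x ≠ y := fun h => hc (by simp [h])
          simp [List.cons_prefix_cons, this]

def boolData (b : Bool) : Data := if b then .node .nil .nil else .nil

/-- Compares the two trees on top. -/
def opEq : Prog :=
  .seq (grab .main) <| .seq (pour .a .b) <| .seq (grab .main) <| .seq (pour .a .c) <|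
    .seq eqLoop <| .seq (drain .c) <| .case .a fun o =>
      if o = none then .seq opNil (.seq opNil opCons) else .seq (drain .a) opNil

theorem runs_eq (x y : Data) (m r : List Sym) :
    Runs opEq (st (x.code ++ (y.code ++ m)) r) (st ((boolData (decide (x = y))).code ++ m) r)
      (20 * (x.size + y.size) + 20) := by
  have h₁ := runs_grab_main x (y.code ++ m) [] r
  have h₂ := runs_pour (k := .a) (k' := .b) (by simp) (mk (y.code ++ m) x.code.reverse [] [] r)
  have h₃ := runs_grab_main y m x.code r
  have h₄ := runs_pour (k := .a) (k' := .c) (by simp) (mk m y.code.reverse x.code [] r)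
  obtain ⟨a', c', h₅, ha, hal, hc⟩ := runs_eqLoop m r x.code [] y.code
  have h₆ := runs_drain .c (mk m a' [] c' r)
  simp only [update_mk_a, update_mk_b, update_mk_c, mk_a, mk_b, mk_c,
    List.reverse_reverse, List.append_nil, List.length_reverse, Data.length_code, true_and,
    List.length_nil, zero_add] at h₁ h₂ h₃ h₄ h₅ h₆ ha hal hc
  have hxy : a' = [] ↔ x = y := by
    rw [ha]
    refine ⟨fun ⟨u, hu⟩ => ?_, fun h => h ▸ List.prefix_rfl⟩
    exact (Data.code_append_inj (hu.trans (List.append_nil _).symm)).1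
  have h₇ : Runs (.case .a fun o =>
      if o = none then .seq opNil (.seq opNil opCons) else .seq (drain .a) opNil)
      (mk m a' [] [] r) (st ((boolData (decide (x = y))).code ++ m) r) (2 * x.size + 4) := by
    by_cases h : a' = []
    · have hx := hxy.1 h
      subst h
      refine (Runs.case (n := 3) ?_).mono (by lia)
      simp only [mk_a, List.head?_nil, if_true, List.tail_nil, update_mk_a]
      rw [decide_eq_true hx]
      exact (runs_nil m r).seq ((runs_nil _ r).seq (runs_cons .nil .nil m r))
    · have hx := mt hxy.2 h
      obtain ⟨s, a', rfl⟩ := List.exists_cons_of_ne_nil h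
      simp only [List.length_cons] at hal
      refine (Runs.case (n := 2 * x.size + 3) ?_)|>.mono (by lia)
      simp only [mk_a, List.head?_cons, reduceCtorEq, if_false, List.tail_cons, update_mk_a]
      rw [decide_eq_false hx]
      have h₈ := runs_drain .a (mk m a' [] [] r)
      simp only [update_mk_a, mk_a] at h₈
      exact (h₈.seq (runs_nil m r)).mono (by lia)
  exact (h₁.seq (h₂.seq (h₃.seq (h₄.seq (h₅.seq (h₆.seq h₇)))))).mono (by lia)

end StackProgram

/-! ### Coded types and polynomial-time functions -/

namespace StackProgram

/-- Types whose elements are represented by trees, with a weight in which running times are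
measured. -/
class Coded (α : Type) where
  enc : α → Data
  wt : α → ℕ
  size_enc_le : ∀ a, (enc a).size ≤ wt a

open Coded

instance : Coded Data := ⟨id, Data.size, fun _ => le_rfl⟩

instance : Coded Bool := ⟨boolData, fun _ => 3, fun b => by cases b <;> simp [boolData, Data.size]⟩

def encodeList {α : Type} [Coded α] : List α → Data
  | [] => .nil
  | x :: l => .node (enc x) (encodeList l)

def listWeight {α : Type} [Coded α] : List α → ℕ
  | [] => 1
  | x :: l => wt x + listWeight l + 1

instance {α : Type} [Coded α] : Coded (List α) where
  enc := encodeList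
  wt := listWeight
  size_enc_le l := by
    induction l with
    | nil => simp [encodeList, listWeight, Data.size]
    | cons x l ih => simpa [encodeList, listWeight, Data.size] using add_le_add (size_enc_le x) ih

instance {α β : Type} [Coded α] [Coded β] : Coded (α × β) where
  enc p := .node (enc p.1) (enc p.2)
  wt p := wt p.1 + wt p.2 + 1
  size_enc_le p := by
    simpa [Data.size] using add_le_add (size_enc_le p.1) (size_enc_le p.2)

section weight

variable {α β : Type} [Coded α] [Coded β]

@[simp] theorem enc_list_nil : enc ([] : List α) = .nil := rfl

@[simp] theorem enc_list_cons (x : α) (l : List α) : enc (x :: l) = .node (enc x) (enc l) := rfl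

@[simp] theorem enc_prod (x : α) (y : β) : enc (x, y) = .node (enc x) (enc y) := rfl

@[simp] theorem wt_list_nil : wt ([] : List α) = 1 := rfl

@[simp] theorem wt_list_cons (x : α) (l : List α) : wt (x :: l) = wt x + wt l + 1 := rfl

@[simp] theorem wt_prod (p : α × β) : wt p = wt p.1 + wt p.2 + 1 := rfl

@[simp] theorem wt_bool (b : Bool) : wt b = 3 := rfl

theorem wt_append (l l' : List α) : wt (l ++ l') + 1 = wt l + wt l' := by
  induction l with
  | nil => simp; lia
  | cons x l ih => simp; lia

theorem length_lt_wt (l : List α) : l.length < wt l := by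
  induction l with
  | nil => simp
  | cons x l ih => simp; lia

theorem wt_le_of_mem {x : α} {l : List α} (h : x ∈ l) : wt x ≤ wt l := by
  induction l with
  | nil => simp at h
  | cons y l ih =>
    rcases List.mem_cons.1 h with rfl | h
    · simp; lia
    · have := ih h
      simp; lia

end weight

/-- Holds because the coefficients are natural numbers; this is why bounds are kept as polynomials
over `ℕ`. -/
theorem eval_mono (q : Polynomial ℕ) {m n : ℕ} (h : m ≤ n) : q.eval m ≤ q.eval n := by
  simp only [Polynomial.eval_eq_sum, Polynomial.sum_def]
  gcongr

/-- Functions computed by a program in polynomial time. -/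
@[fun_prop]
def PT {α β : Type} [Coded α] [Coded β] (f : α → β) : Prop :=
  ∃ (p : Prog) (q : Polynomial ℕ), ∀ a, wt (f a) ≤ q.eval (wt a) ∧
    ∀ m r, Runs p (st ((enc a).code ++ m) r) (st ((enc (f a)).code ++ m) r) (q.eval (wt a))

/-! ### Closure properties of polynomial-time functions -/

section

variable {α β γ δ : Type} [Coded α] [Coded β] [Coded γ] [Coded δ]

open Polynomial (X C)

/-- A variant of the definition with separate bounds for weight and time. -/
theorem PT.intro {f : α → β} (p : Prog) (q q' : Polynomial ℕ) (hq : ∀ a, wt (f a) ≤ q.eval (wt a))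
    (hp : ∀ a m r, Runs p (st ((enc a).code ++ m) r) (st ((enc (f a)).code ++ m) r)
      (q'.eval (wt a))) : PT f := by
  refine ⟨p, q + q', fun a => ⟨?_, fun m r => (hp a m r).mono ?_⟩⟩
  · rw [Polynomial.eval_add]; exact (hq a).trans (Nat.le_add_right _ _)
  · rw [Polynomial.eval_add]; exact Nat.le_add_left _ _

/-- Functions that agree up to the representation. -/
theorem PT.congr_enc {f : α → β} {g : α → γ} (hf : PT f) (h : ∀ a, enc (g a) = enc (f a))
    (q : Polynomial ℕ) (hq : ∀ a, wt (g a) ≤ q.eval (wt a)) : PT g := by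
  obtain ⟨p, q', hp⟩ := hf
  exact .intro p q q' hq fun a m r => by rw [h]; exact (hp a).2 m r

@[fun_prop]
theorem PT.identity : PT fun a : α => a :=
  .intro .skip X 1 (fun a => by simp) fun a m r => by simpa using Runs.skip _

@[fun_prop]
theorem PT.comp {g : β → γ} {f : α → β} (hg : PT g) (hf : PT f) : PT fun a => g (f a) := by
  obtain ⟨p, q, hp⟩ := hf
  obtain ⟨p', q', hp'⟩ := hg
  refine .intro (.seq p p') (q'.comp q) (q + q'.comp q) (fun a => ?_) fun a m r => ?_
  · rw [Polynomial.eval_comp]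
    exact (hp' _).1.trans (eval_mono _ (hp a).1)
  · rw [Polynomial.eval_add, Polynomial.eval_comp]
    exact ((hp a).2 m r).seq (((hp' _).2 m r).mono (eval_mono _ (hp a).1))

def pushData : Data → Prog
  | .nil => opNil
  | .node x y => .seq (pushData y) (.seq (pushData x) opCons)

theorem runs_pushData (x : Data) : ∀ m r, Runs (pushData x) (st m r) (st (x.code ++ m) r)
    (2 * x.size) := by
  induction x with
  | nil => exact fun m r => (runs_nil m r).mono (by simp [Data.size])
  | node x y ihx ihy =>
    intro m r
    exact ((ihy m r).seq ((ihx _ r).seq (runs_cons x y m r))).mono (by simp [Data.size]; lia)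

@[fun_prop]
theorem PT.const (b : β) : PT fun _ : α => b := by
  refine .intro (.seq opDrop (pushData (enc b))) (C (wt b)) (7 * X + C (3 + 2 * (enc b).size))
    (by simp) fun a m r => ?_
  refine ((runs_drop (enc a) m r).seq (runs_pushData (enc b) m r)).mono ?_
  have := size_enc_le a
  simp
  lia

@[fun_prop]
theorem PT.fst : PT fun p : α × β => p.1 := by
  refine .intro (opCase .skip (.seq opSwap opDrop)) X (30 * X + 20) (fun p => by simp; lia)
    fun p m r => ?_
  have h := runs_case_node (p := .skip) ((runs_swap (enc p.1) (enc p.2) m r).seq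
    (runs_drop (enc p.2) _ r))
  refine h.mono ?_
  have h₁ := size_enc_le p.1
  have h₂ := size_enc_le p.2
  simp
  lia

@[fun_prop]
theorem PT.snd : PT fun p : α × β => p.2 := by
  refine .intro (opCase .skip opDrop) X (30 * X + 20) (fun p => by simp; lia) fun p m r => ?_
  refine (runs_case_node (p := .skip) (runs_drop (enc p.1) _ r)).mono ?_
  have h₁ := size_enc_le p.1
  simp
  lia

@[fun_prop]
theorem PT.pair {f : α → β} {g : α → γ} (hf : PT f) (hg : PT g) : PT fun a => (f a, g a) := by
  obtain ⟨p, q, hp⟩ := hf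
  obtain ⟨p', q', hp'⟩ := hg
  refine .intro (.seq opDup (.seq p (.seq opSwap (.seq p' (.seq opSwap opCons))))) (q + q' + 1)
    (30 * X + 30 * q + 30 * q' + 30) (fun a => ?_) fun a m r => ?_
  · have h₁ := (hp a).1
    have h₂ := (hp' a).1
    simp
    lia
  · refine ((runs_dup (enc a) m r).seq (((hp a).2 _ r).seq ((runs_swap _ _ _ r).seq
      (((hp' a).2 _ r).seq ((runs_swap _ _ _ r).seq (runs_cons _ _ m r)))))).mono ?_
    have h₁ := (hp a).1
    have h₂ := (hp' a).1
    have h₃ := size_enc_le a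
    have h₄ := size_enc_le (f a)
    have h₅ := size_enc_le (g a)
    simp
    lia

@[fun_prop]
theorem PT.ite {c : α → Bool} {f g : α → β} (hc : PT c) (hf : PT f) (hg : PT g) :
    PT fun a => if c a then f a else g a := by
  obtain ⟨p₀, q₀, hp₀⟩ := hc
  obtain ⟨p, q, hp⟩ := hf
  obtain ⟨p', q', hp'⟩ := hg
  -- `true` is a node with two leaves, so `opCase` leaves two leaves on the stack, which the two
  -- `opDrop` remove.
  refine .intro (.seq opDup (.seq p₀ (opCase p' (.seq opDrop (.seq opDrop p))))) (q + q')
    (30 * X + q₀ + q + q' + 30) (fun a => ?_) fun a m r => ?_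
  · have h₁ := (hp a).1
    have h₂ := (hp' a).1
    simp
    split <;> lia
  · have h : Runs (opCase p' (.seq opDrop (.seq opDrop p)))
        (st ((enc (c a)).code ++ ((enc a).code ++ m)) r)
        (st ((enc (if c a then f a else g a)).code ++ m) r)
        ((q + q').eval (wt a) + 21) := by
      by_cases h : c a
      · have h₁ : enc (c a) = .node .nil .nil := by rw [h]; rfl
        rw [h₁]
        simp only [h, if_true]
        refine (runs_case_node ((runs_drop .nil _ r).seq ((runs_drop .nil _ r).seq
          ((hp a).2 m r)))).mono ?_
        simp [Data.size]
        lia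
      · have h₁ : enc (c a) = .nil := by rw [Bool.not_eq_true] at h; rw [h]; rfl
        rw [h₁]
        simp only [h]
        refine (runs_case_nil ((hp' a).2 m r)).mono ?_
        simp
        lia
    refine ((runs_dup (enc a) m r).seq (((hp₀ a).2 _ r).seq h)).mono ?_
    have h₃ := size_enc_le a
    simp
    lia

theorem PT.eq_enc {f : α → β} {g : α → γ} (hf : PT f) (hg : PT g) :
    PT fun a => decide (enc (f a) = enc (g a)) := by
  have h : PT fun p : β × γ => decide (enc p.1 = enc p.2) := by
    refine .intro (opCase .skip opEq) 3 (20 * X + 30) (by simp) fun p m r => ?_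
    refine (runs_case_node (p := .skip) (runs_eq (enc p.1) (enc p.2) m r)).mono ?_
    have h₁ := size_enc_le p.1
    have h₂ := size_enc_le p.2
    simp
    lia
  exact h.comp (hf.pair hg)

@[fun_prop]
theorem PT.cons {f : α → β} {g : α → List β} (hf : PT f) (hg : PT g) :
    PT fun a => f a :: g a := by
  obtain ⟨_, q, h⟩ := hf.pair hg
  exact (hf.pair hg).congr_enc (fun a => rfl) q fun a => (h a).1

theorem PT.listCase {f : α → List β} {g : α → γ} {h : α → β → List β → γ} (hf : PT f) (hg : PT g)
    (hh : PT fun p : α × β × List β => h p.1 p.2.1 p.2.2) :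
    PT fun a => match f a with
      | [] => g a
      | x :: l => h a x l := by
  obtain ⟨p, q, hp⟩ := hf
  obtain ⟨p₁, q₁, hp₁⟩ := hg
  obtain ⟨p₂, q₂, hp₂⟩ := hh
  -- A copy of the argument lies below the list. In the nonempty branch the pair of head and tail is
  -- rebuilt, and the copy is put in front of it to form the argument of `p₂`.
  refine .intro (.seq opDup (.seq p (opCase p₁ (.seq opCons (.seq opSwap (.seq opCons p₂))))))
    (q₁ + q₂.comp (X + q + 1)) (40 * X + 40 * q + q₁ + q₂.comp (X + q + 1) + 40)
    (fun a => ?_) fun a m r => ?_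
  · have h₁ := (hp₁ a).1
    have h₃ := (hp a).1
    simp only [Polynomial.eval_add, Polynomial.eval_comp, Polynomial.eval_X, Polynomial.eval_one]
    split
    · lia
    · rename_i x l hl
      rw [hl] at h₃
      have h₂ := (hp₂ (a, x, l)).1.trans (eval_mono q₂ (n := wt a + q.eval (wt a) + 1)
        (by simp at h₃ ⊢; lia))
      exact h₂.trans (Nat.le_add_left _ _)
  · refine ((runs_dup (enc a) m r).seq (((hp a).2 _ r).seq
      (n' := 20 * wt a + 20 * q.eval (wt a) + q₁.eval (wt a) +
        q₂.eval (wt a + q.eval (wt a) + 1) + 20) ?_)).mono ?_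
    · have h₃ := (hp a).1
      cases hl : f a with
      | nil => exact (runs_case_nil ((hp₁ a).2 m r)).mono (by lia)
      | cons x l =>
        rw [hl] at h₃
        have h₂ := ((hp₂ (a, x, l)).2 m r).mono (eval_mono q₂ (n := wt a + q.eval (wt a) + 1)
          (by simp at h₃ ⊢; lia))
        refine (runs_case_node ((runs_cons (enc x) (enc l) _ r).seq
          ((runs_swap _ _ m r).seq ((runs_cons _ _ m r).seq h₂)))).mono ?_
        have h₄ := size_enc_le a
        have h₅ := size_enc_le (x, l)
        simp [Data.size] at h₃ h₅ ⊢
        lia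
    · have h₄ := size_enc_le a
      simp
      lia

/-- The unread part of the list waits on `r` while `p` acts on the pair of element and state. -/
def foldBody (p : Prog) : Prog := .seq opSwap (.seq opToR (.seq opCons (.seq p opFromR)))

/-- `W` bounds the list and every intermediate state, so all rounds have the same cost bound. -/
theorem runs_fold {p : Prog} {q : Polynomial ℕ} {step : β → γ → γ}
    (hp : ∀ x s m r, Runs p (st ((Data.node (enc x) (enc s)).code ++ m) r)
      (st ((enc (step x s)).code ++ m) r) (q.eval (wt x + wt s + 1))) (W : ℕ) :
    ∀ (l : List β) (s : γ), wt l ≤ W →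
      (∀ l₁ l₂, l = l₁ ++ l₂ → wt (l₁.foldl (fun s x => step x s) s) ≤ W) → ∀ m r,
      Runs (whileBody (foldBody p))
        (mk ((enc l).code ++ ((enc s).code ++ m)) [] [] [one] r)
        (st ((enc (l.foldl (fun s x => step x s) s)).code ++ m) r)
        (l.length * (q.eval (2 * W + 1) + 50 * W + 30) + 4) := by
  intro l
  induction l with
  | nil => exact fun s _ _ m r => (runs_whileBody_nil _ _ r).mono (by simp)
  | cons x l ih =>
    intro s hl hs m r
    simp only [wt_list_cons] at hl
    have h₁ := ih (step x s) (by lia) (fun l₁ l₂ h => hs (x :: l₁) l₂ (by simp [h])) m r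
    have h₂ : wt s ≤ W := hs [] _ rfl
    have h₃ := (hp x s m ((enc l).code ++ r)).mono (eval_mono q (n := 2 * W + 1) (by lia))
    have h₄ := (runs_swap (enc x) (enc l) ((enc s).code ++ m) r).seq
      ((runs_toR (enc l) _ r).seq ((runs_cons (enc x) (enc s) m _).seq
        (h₃.seq (runs_fromR (enc l) _ r))))
    refine (runs_whileBody_node h₄ h₁).mono ?_
    have h₅ := size_enc_le x
    have h₆ := size_enc_le l
    simp only [List.length_cons, add_mul, one_mul]
    lia

/-- Iterating a polynomial-time step can produce exponentially large states; the bound `hq` on all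
intermediate states excludes this. -/
theorem PT.foldl_of_bound {f : α → List β} {init : α → γ} {step : α → γ → β → γ} (hf : PT f)
    (hi : PT init) (hs : PT fun p : α × γ × β => step p.1 p.2.1 p.2.2) (q : Polynomial ℕ)
    (hq : ∀ a l₁ l₂, f a = l₁ ++ l₂ → wt (l₁.foldl (step a) (init a)) ≤ q.eval (wt a)) :
    PT fun a => (f a).foldl (step a) (init a) := by
  obtain ⟨p₁, q₁, hp₁⟩ : PT fun a => (f a, init a, a) := by fun_prop
  obtain ⟨p₂, q₂, hp₂⟩ : PT fun p : β × γ × α => (step p.2.2 p.2.1 p.1, p.2.2) :=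
    (hs.comp (f := fun p : β × γ × α => (p.2.2, p.2.1, p.1)) (by fun_prop)).pair (by fun_prop)
  obtain ⟨p₃, q₃, hp₃⟩ : PT fun p : γ × α => p.1 := by fun_prop
  have hfold : ∀ a (l : List β) (s : γ), l.foldl (fun s x => (step s.2 s.1 x, s.2)) (s, a) =
      (l.foldl (step a) s, a) := by
    intro a l
    induction l with
    | nil => simp
    | cons x l ih => simp [ih]
  let W : Polynomial ℕ := q₁ + q + X + 1
  -- `p₁` lays out the list above the initial state, `opCase` strips the outer pair, and `p₃`
  -- finally discards the copy of `a` that the state carries because the step depends on `a`.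
  refine .intro (.seq p₁ (.seq (opCase .skip .skip) (.seq (opWhile (foldBody p₂)) p₃))) q
    (q₁ + W * (q₂.comp (2 * W + 1) + 50 * W + 30) + q₃.comp W + 20)
    (fun a => hq a (f a) [] (by simp)) fun a m r => ?_
  have hW : W.eval (wt a) = q₁.eval (wt a) + q.eval (wt a) + wt a + 1 := by simp [W]
  have h₁ := (hp₁ a).1
  simp only [wt_prod] at h₁
  have hlen := length_lt_wt (f a)
  have h₂ := runs_fold (p := p₂) (q := q₂) (step := fun x (s : γ × α) => (step s.2 s.1 x, s.2))
    (fun x s m r => by simpa [add_assoc] using (hp₂ (x, s)).2 m r) (W.eval (wt a)) (f a) (init a, a)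
    (by lia) (fun l₁ l₂ h => by
      have := hq a l₁ l₂ h
      rw [hfold]; simp only [wt_prod]; lia) m r
  rw [hfold] at h₂
  have h₃ := hq a (f a) [] (by simp)
  have h₄ := ((hp₃ ((f a).foldl (step a) (init a), a)).2 m r).mono
    (eval_mono q₃ (n := W.eval (wt a)) (by simp only [wt_prod]; lia))
  have h₅ := ((hp₁ a).2 m r).seq ((runs_case_node (p := .skip) (Runs.skip _)).seq
    ((runs_while h₂).seq h₄))
  refine h₅.mono ?_
  have h₆ : (f a).length * (q₂.eval (2 * W.eval (wt a) + 1) + 50 * W.eval (wt a) + 30) ≤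
      W.eval (wt a) * (q₂.eval (2 * W.eval (wt a) + 1) + 50 * W.eval (wt a) + 30) :=
    Nat.mul_le_mul_right _ (by lia)
  simp only [Polynomial.eval_add, Polynomial.eval_mul, Polynomial.eval_comp, Polynomial.eval_one,
    Polynomial.eval_ofNat]
  lia

/-- The growth of one step is additive and its bound does not depend on the state, so the
intermediate states are bounded by the initial weight plus the length of the list times one
increment. -/
theorem PT.foldl {f : α → List β} {init : α → γ} {step : α → γ → β → γ} (hf : PT f)
    (hi : PT init) (hs : PT fun p : α × γ × β => step p.1 p.2.1 p.2.2) (q : Polynomial ℕ)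
    (hq : ∀ a s x, wt (step a s x) ≤ wt s + q.eval (wt a + wt x)) :
    PT fun a => (f a).foldl (step a) (init a) := by
  have hb : ∀ a (W : ℕ) (l : List β) (s : γ), (∀ x ∈ l, wt x ≤ W) →
      wt (l.foldl (step a) s) ≤ wt s + l.length * q.eval (wt a + W) := by
    intro a W l
    induction l with
    | nil => simp
    | cons x l ih =>
      intro s h
      have h₁ := ih (step a s x) fun y hy => h y (by simp [hy])
      have h₂ := hq a s x
      have h₃ := eval_mono q (show wt a + wt x ≤ wt a + W by have := h x (by simp); lia)
      simp only [List.foldl_cons, List.length_cons, add_mul, one_mul]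
      lia
  obtain ⟨_, q₁, h₁⟩ := id hf
  obtain ⟨_, q₂, h₂⟩ := id hi
  refine .foldl_of_bound hf hi hs (q₂ + q₁ * q.comp (X + q₁)) fun a l₁ l₂ h => ?_
  have h₃ := (h₁ a).1
  have h₄ := (h₂ a).1
  have h₅ := hb a (q₁.eval (wt a)) l₁ (init a) fun x hx =>
    (wt_le_of_mem (by rw [h]; simp [hx])).trans h₃
  have h₆ : l₁.length ≤ q₁.eval (wt a) := by
    have := length_lt_wt (f a)
    rw [h, List.length_append, ← h] at this
    lia
  have h₇ := Nat.mul_le_mul_right (q.eval (wt a + q₁.eval (wt a))) h₆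
  simp only [Polynomial.eval_add, Polynomial.eval_mul, Polynomial.eval_comp, Polynomial.eval_X]
  lia

@[fun_prop]
theorem PT.reverse {f : α → List β} (hf : PT f) : PT fun a => (f a).reverse := by
  have h : PT fun a => (f a).foldl (fun l x => x :: l) [] :=
    .foldl hf (by fun_prop) (by fun_prop) (X + 1) fun a s x => by simp; lia
  simpa using h

theorem PT.foldr_of_bound {f : α → List β} {init : α → γ} {step : α → β → γ → γ} (hf : PT f)
    (hi : PT init) (hs : PT fun p : α × β × γ => step p.1 p.2.1 p.2.2) (q : Polynomial ℕ)
    (hq : ∀ a l₁ l₂, f a = l₁ ++ l₂ → wt (l₂.foldr (step a) (init a)) ≤ q.eval (wt a)) :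
    PT fun a => (f a).foldr (step a) (init a) := by
  have h : PT fun a => (f a).reverse.foldl (fun s x => step a x s) (init a) := by
    refine .foldl_of_bound hf.reverse hi
      (hs.comp (f := fun p : α × γ × β => (p.1, p.2.2, p.2.1)) (by fun_prop)) q fun a l₁ l₂ h => ?_
    have h₁ := hq a l₂.reverse l₁.reverse (by rw [← List.reverse_append, ← h, List.reverse_reverse])
    rwa [List.foldr_reverse] at h₁
  simpa only [List.foldl_reverse] using h

theorem PT.foldr {f : α → List β} {init : α → γ} {step : α → β → γ → γ} (hf : PT f)
    (hi : PT init) (hs : PT fun p : α × β × γ => step p.1 p.2.1 p.2.2) (q : Polynomial ℕ)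
    (hq : ∀ a x s, wt (step a x s) ≤ wt s + q.eval (wt a + wt x)) :
    PT fun a => (f a).foldr (step a) (init a) := by
  have h : PT fun a => (f a).reverse.foldl (fun s x => step a x s) (init a) :=
    .foldl hf.reverse hi
      (hs.comp (f := fun p : α × γ × β => (p.1, p.2.2, p.2.1)) (by fun_prop)) q
      fun a s x => hq a x s
  simpa only [List.foldl_reverse] using h

@[fun_prop]
theorem PT.append {f g : α → List β} (hf : PT f) (hg : PT g) : PT fun a => f a ++ g a := by
  have h : PT fun a => (f a).foldr (fun x l => x :: l) (g a) :=
    .foldr hf hg (by fun_prop) (X + 1) fun a x s => by simp; lia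
  simpa using h

theorem PT.map {f : α → List β} {g : α → β → γ} (hf : PT f) (hg : PT fun p : α × β => g p.1 p.2) :
    PT fun a => (f a).map (g a) := by
  obtain ⟨_, q, hq⟩ := id hg
  have h : PT fun a => (f a).foldr (fun x l => g a x :: l) [] :=
    .foldr (step := fun a x l => g a x :: l) hf (by fun_prop)
      ((hg.comp (f := fun p : α × β × List γ => (p.1, p.2.1)) (by fun_prop)).cons (by fun_prop))
      (q.comp (X + 1) + 1) fun a x s => by
        have := (hq (a, x)).1
        simp at this ⊢
        lia
  simpa using h

theorem PT.flatMap {f : α → List β} {g : α → β → List γ} (hf : PT f)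
    (hg : PT fun p : α × β => g p.1 p.2) : PT fun a => (f a).flatMap (g a) := by
  obtain ⟨_, q, hq⟩ := id hg
  have h : PT fun a => (f a).foldr (fun x l => g a x ++ l) [] :=
    .foldr (step := fun a x l => g a x ++ l) hf (by fun_prop)
      ((hg.comp (f := fun p : α × β × List γ => (p.1, p.2.1)) (by fun_prop)).append (by fun_prop))
      (q.comp (X + 1) + 1) fun a x s => by
        have := (hq (a, x)).1
        have := wt_append (g a x) s
        simp at *
        lia
  have h' : ∀ a, (f a).flatMap (g a) = (f a).foldr (fun x l => g a x ++ l) [] := by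
    intro a
    induction f a with
    | nil => rfl
    | cons x l ih => simp [ih]
  simpa only [h'] using h

theorem PT.filter {f : α → List β} {g : α → β → Bool} (hf : PT f)
    (hg : PT fun p : α × β => g p.1 p.2) : PT fun a => (f a).filter (g a) := by
  have h : PT fun a => (f a).flatMap fun x => if g a x then [x] else [] :=
    .flatMap hf (hg.ite (by fun_prop) (by fun_prop))
  have h' : ∀ a, (f a).filter (g a) = (f a).flatMap fun x => if g a x then [x] else [] := by
    intro a
    induction f a with
    | nil => rfl
    | cons x l ih => by_cases hx : g a x <;> simp [ih, hx]
  simpa only [h'] using h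

@[fun_prop]
theorem PT.and {f g : α → Bool} (hf : PT f) (hg : PT g) : PT fun a => f a && g a := by
  have h : PT fun a => if f a then g a else false := by fun_prop
  have h' : ∀ a, (f a && g a) = if f a then g a else false := fun a => by cases f a <;> simp
  simpa only [h'] using h

@[fun_prop]
theorem PT.not {f : α → Bool} (hf : PT f) : PT fun a => !f a := by
  have h : PT fun a => if f a then false else true := by fun_prop
  have h' : ∀ a, (!f a) = if f a then false else true := fun a => by cases f a <;> simp
  simpa only [h'] using h

@[fun_prop]
theorem PT.or {f g : α → Bool} (hf : PT f) (hg : PT g) : PT fun a => f a || g a := by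
  have h : PT fun a => if f a then true else g a := by fun_prop
  have h' : ∀ a, (f a || g a) = if f a then true else g a := fun a => by cases f a <;> simp
  simpa only [h'] using h

theorem PT.all {f : α → List β} {g : α → β → Bool} (hf : PT f)
    (hg : PT fun p : α × β => g p.1 p.2) : PT fun a => (f a).all (g a) := by
  have h : PT fun a => (f a).foldr (fun x b => g a x && b) true :=
    .foldr (step := fun a x b => g a x && b) hf (by fun_prop)
      ((hg.comp (f := fun p : α × β × Bool => (p.1, p.2.1)) (by fun_prop)).and (by fun_prop))
      0 fun a x s => by simp
  have h' : ∀ a, (f a).all (g a) = (f a).foldr (fun x b => g a x && b) true := by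
    intro a
    induction f a with
    | nil => rfl
    | cons x l ih => simp [← ih]
  simpa only [h'] using h

theorem PT.any {f : α → List β} {g : α → β → Bool} (hf : PT f)
    (hg : PT fun p : α × β => g p.1 p.2) : PT fun a => (f a).any (g a) := by
  have h : PT fun a => !(f a).all fun x => !g a x := (PT.all hf hg.not).not
  have h' : ∀ a, (f a).any (g a) = !(f a).all fun x => !g a x := by
    intro a
    simp [List.not_all_eq_any_not]
  simpa only [h'] using h

@[fun_prop]
-- A fold over the first list whose state holds the unread rest of the second list and the pairs
-- found so far, in reverse.
theorem PT.zip {f : α → List β} {g : α → List γ} (hf : PT f) (hg : PT g) :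
    PT fun a => (f a).zip (g a) := by
  have h : PT fun a => ((f a).foldl (fun (s : List γ × List (β × γ)) x =>
      match s.1 with
      | [] => ([], s.2)
      | y :: l => (l, (x, y) :: s.2)) (g a, [])).2.reverse := by
    refine .reverse (PT.snd.comp (.foldl (α := α) hf (by fun_prop) ?_ (X + 2) ?_))
    · exact .listCase (α := α × (List γ × List (β × γ)) × β) (by fun_prop) (by fun_prop)
        (by fun_prop)
    · rintro a ⟨l, l'⟩ x
      cases l with
      | nil => simp
      | cons y l => simp; lia
  have h' : ∀ (l : List β) (l' : List γ) (l'' : List (β × γ)),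
      (l.foldl (fun (s : List γ × List (β × γ)) x =>
        match s.1 with
        | [] => ([], s.2)
        | y :: l => (l, (x, y) :: s.2)) (l', l'')).2 = (l.zip l').reverse ++ l'' := by
    intro l
    induction l with
    | nil => simp
    | cons x l ih => intro l' l''; cases l' <;> simp [ih]
  simpa [h'] using h

@[fun_prop]
theorem PT.isEmpty {f : α → List β} (hf : PT f) : PT fun a => (f a).isEmpty := by
  have h : PT fun a => match f a with
      | [] => true
      | _ :: _ => false := .listCase hf (by fun_prop) (by fun_prop)
  have h' : ∀ l : List β, l.isEmpty = match l with
      | [] => true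
      | _ :: _ => false := fun l => by cases l <;> rfl
  simpa only [h'] using h

end

end StackProgram

/-! ### Systems of equations between terms and values, and matchings of atoms with facts -/

namespace ConjQuery

def Term.isVar : Term → Bool
  | .var _ => true
  | .const _ => false

/-- The variable or the constant that the term consists of. -/
def Term.name : Term → ℕ
  | .var x => x
  | .const c => c

/-- The equations `t = v`, for all `(t, v)` in the list, are satisfiable. -/
def consistent (l : List (Term × ℕ)) : Bool :=
  l.all fun p => (p.1.isVar || decide (p.1.name = p.2)) &&
    l.all fun q => !(decide (p.1 = q.1)) || decide (p.2 = q.2)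

def Solves (θ : ℕ → ℕ) (l : List (Term × ℕ)) : Prop := ∀ p ∈ l, p.1.subst θ = p.2

theorem consistent_iff {l : List (Term × ℕ)} : consistent l ↔ ∃ θ, Solves θ l := by
  classical
  constructor
  · intro h
    simp only [consistent, List.all_eq_true, Bool.and_eq_true, Bool.or_eq_true, Bool.not_eq_true',
      decide_eq_false_iff_not, decide_eq_true_eq] at h
    -- Any prescribed value may be chosen, since consistency makes it unique; variables without an
    -- equation get the irrelevant value 0.
    refine ⟨fun x => if h : ∃ v, (Term.var x, v) ∈ l then h.choose else 0, ?_⟩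
    rintro ⟨t, v⟩ hp
    cases t with
    | const c => simpa [Term.isVar, Term.name, Term.subst] using (h _ hp).1
    | var x =>
      have hx : ∃ v, (Term.var x, v) ∈ l := ⟨v, hp⟩
      simp only [Term.subst, dif_pos hx]
      simpa using (h _ hx.choose_spec).2 _ hp
  · rintro ⟨θ, h⟩
    simp only [consistent, List.all_eq_true, Bool.and_eq_true, Bool.or_eq_true, Bool.not_eq_true',
      decide_eq_false_iff_not, decide_eq_true_eq]
    refine fun p hp => ⟨?_, fun q hq => ?_⟩
    · have := h p hp
      rcases p with ⟨⟨x⟩ | ⟨c⟩, v⟩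
      · exact .inl rfl
      · exact .inr this
    · by_cases hpq : p.1 = q.1
      · exact .inr (by rw [← h p hp, ← h q hq, hpq])
      · exact .inl hpq

theorem solves_append {θ : ℕ → ℕ} {l l' : List (Term × ℕ)} :
    Solves θ (l ++ l') ↔ Solves θ l ∧ Solves θ l' := by
  simp [Solves, or_imp, forall_and]

/-- Equal lengths are essential: `zip` would silently cut off the longer list. -/
theorem solves_zip_iff {θ : ℕ → ℕ} {A : Atom} {f : Fact} (hr : A.rel = f.rel)
    (hl : A.args.length = f.args.length) :
    Solves θ (A.args.zip f.args) ↔ A.subst θ = f := by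
  have h : ∀ (ts : List Term) (vs : List ℕ), ts.length = vs.length →
      (Solves θ (ts.zip vs) ↔ ts.map (Term.subst θ) = vs) := by
    intro ts
    induction ts with
    | nil => intro vs h; cases vs <;> simp_all [Solves]
    | cons t ts ih =>
      intro vs h
      cases vs with
      | nil => simp at h
      | cons v vs =>
        have := ih vs (by simpa using h)
        simp only [Solves] at this
        simp [Solves, ← this]
  rw [h _ _ hl]
  obtain ⟨r, vs⟩ := f
  simp only at hr
  simp [Atom.subst, hr]

/-- All ways to match the first `k` atoms of a list with facts. -/
def matchings (facts : List Fact) : ℕ → List Atom → List (List (Term × ℕ))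
  | 0, _ => [[]]
  | k + 1, As =>
    match As with
    | [] => [[]]
    | A :: As => facts.flatMap fun f =>
      if decide (A.rel = f.rel) then (matchings facts k As).map fun τ => A.args.zip f.args ++ τ
      else []

/-- The bound on the length guarantees that no atom lies beyond the first `k`, where `matchings`
stops. -/
theorem exists_of_mem_matchings {facts : List Fact} {k : ℕ} {As : List Atom} (hk : As.length ≤ k)
    {τ : List (Term × ℕ)} (h : τ ∈ matchings facts k As) {A : Atom} (hA : A ∈ As) :
    ∃ f ∈ facts, A.rel = f.rel ∧ A.args.zip f.args ⊆ τ := by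
  induction k generalizing As τ with
  | zero => simp_all
  | succ k ih =>
    cases As with
    | nil => simp at hA
    | cons B As =>
      simp only [matchings, List.mem_flatMap] at h
      obtain ⟨f, hf, h⟩ := h
      split at h
      · rename_i hr
        obtain ⟨τ, hτ, rfl⟩ := List.mem_map.1 h
        rcases List.mem_cons.1 hA with rfl | hA
        · exact ⟨f, hf, by simpa using hr, List.subset_append_left _ _⟩
        · obtain ⟨g, hg, hr, hs⟩ := ih (by simpa using hk) hτ hA
          exact ⟨g, hg, hr, List.subset_append_of_subset_right _ hs⟩
      · simp at h

theorem exists_mem_matchings {facts : List Fact} {θ : ℕ → ℕ} (k : ℕ) {As : List Atom}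
    (h : ∀ A ∈ As, A.subst θ ∈ facts) : ∃ τ ∈ matchings facts k As, Solves θ τ := by
  induction k generalizing As with
  | zero => exact ⟨[], by simp [matchings], by simp [Solves]⟩
  | succ k ih =>
    cases As with
    | nil => exact ⟨[], by simp [matchings], by simp [Solves]⟩
    | cons A As =>
      obtain ⟨τ, hτ, hs⟩ := ih fun B hB => h B (List.mem_cons_of_mem _ hB)
      refine ⟨A.args.zip (A.subst θ).args ++ τ, ?_, solves_append.2 ⟨?_, hs⟩⟩
      · simp only [matchings, List.mem_flatMap]
        exact ⟨_, h A (by simp), by simpa [Atom.subst] using hτ⟩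
      · exact (solves_zip_iff rfl (by simp [Atom.subst])).2 rfl

/-! ### Semijoin reduction and the satisfiability test -/

section semijoins

variable {V T : Type}

/-- Keeps those elements of each relation that match an element of each later relation. -/
def semijoins (rel : V → List T) (ok : T → T → Bool) (l : List V) : List (List T) :=
  l.foldr (fun v Rs => ((rel v).filter fun t => Rs.all fun R => R.any fun t' => ok t t') :: Rs) []

theorem length_semijoins (rel : V → List T) (ok : T → T → Bool) (l : List V) :
    (semijoins rel ok l).length = l.length := by
  induction l with
  | nil => rfl
  | cons v l ih => simpa [semijoins] using ih

/-- Each relation is filtered against later ones that are already in their final form, so one pass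
suffices. -/
theorem pairwise_semijoins (rel : V → List T) (ok : T → T → Bool) (l : List V) :
    (semijoins rel ok l).Pairwise fun R R' => ∀ t ∈ R, ∃ t' ∈ R', ok t t' := by
  induction l with
  | nil => exact .nil
  | cons v l ih =>
    refine .cons (fun R hR t ht => ?_) ih
    rw [List.mem_filter, List.all_eq_true] at ht
    simpa using ht.2 R hR

theorem getElem_semijoins_subset (rel : V → List T) (ok : T → T → Bool) (l : List V) (i : ℕ)
    (hi : i < l.length) :
    (semijoins rel ok l)[i]'(by rwa [length_semijoins]) ⊆ rel l[i] := by
  induction l generalizing i with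
  | nil => simp at hi
  | cons v l ih =>
    cases i with
    | zero => exact fun t ht => List.mem_of_mem_filter ht
    | succ i => exact ih i (by simpa using hi)

/-- Used with `P` the property of being solved by one fixed substitution: the tuples that come from
a global solution support each other and are never removed. -/
theorem exists_mem_of_mem_semijoins (rel : V → List T) (ok : T → T → Bool) (P : T → Prop)
    (hP : ∀ t t', P t → P t' → ok t t') (l : List V) (h : ∀ v ∈ l, ∃ t ∈ rel v, P t) :
    ∀ R ∈ semijoins rel ok l, ∃ t ∈ R, P t := by
  induction l with
  | nil => simp [semijoins]
  | cons v l ih =>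
    have ih := ih fun w hw => h w (List.mem_cons_of_mem _ hw)
    intro R hR
    rcases List.mem_cons.1 hR with rfl | hR
    · obtain ⟨t, ht, hPt⟩ := h v (by simp)
      refine ⟨t, ?_, hPt⟩
      rw [List.mem_filter, List.all_eq_true]
      refine ⟨ht, fun R hR => ?_⟩
      obtain ⟨t', ht', hPt'⟩ := ih R hR
      simpa using ⟨t', ht', hP t t' hPt hPt'⟩
    · exact ih R hR

end semijoins

/-- The relation at a vertex: matchings of its atoms with facts, restricted to its variables, that
are compatible with `σ` and with every single atom of the query. -/
def vertexRel (k : ℕ) (facts : List Fact) (body : List Atom) (σ : List (Term × ℕ))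
    (v : List ℕ × List Atom) : List (List (Term × ℕ)) :=
  ((matchings facts k v.2.dedup).map fun τ =>
    τ.filter fun p => v.1.any fun x => decide (p.1 = Term.var x)).filter fun τ =>
      consistent (τ ++ σ) && body.all fun A => facts.any fun f =>
        decide (A.rel = f.rel) && consistent (A.args.zip f.args ++ τ)

/-- Decides whether a solution of `σ` sends all atoms of the body to facts. -/
def satisfiable (k : ℕ) (facts : List Fact) (body : List Atom) (vs : List (List ℕ × List Atom))
    (σ : List (Term × ℕ)) : Bool :=
  consistent σ &&
    (semijoins (vertexRel k facts body σ) (fun τ τ' => consistent (τ ++ τ')) vs).all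
      fun R => !R.isEmpty

/-- The labels of the vertices. -/
def Hypertree.labels (H : Hypertree) : List (List ℕ × List Atom) :=
  List.ofFn fun p : Fin (H.n + 1) => (H.chiList p, H.lamList p)

/-- The restrictions of `θ` to the vertices pass every filter. This direction needs of the
decomposition only that the labels consist of body atoms. -/
theorem satisfiable_of_solves {k : ℕ} {facts : List Fact} {body : List Atom}
    {vs : List (List ℕ × List Atom)} (hvs : ∀ v ∈ vs, v.2 ⊆ body) {σ : List (Term × ℕ)} {θ : ℕ → ℕ}
    (hθ : ∀ A ∈ body, A.subst θ ∈ facts) (hσ : Solves θ σ) : satisfiable k facts body vs σ := by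
  have key := exists_mem_of_mem_semijoins (vertexRel k facts body σ)
    (fun τ τ' => consistent (τ ++ τ')) (Solves θ)
    (fun τ τ' h h' => consistent_iff.2 ⟨θ, solves_append.2 ⟨h, h'⟩⟩) vs ?_
  · simp only [satisfiable, Bool.and_eq_true, List.all_eq_true]
    refine ⟨consistent_iff.2 ⟨θ, hσ⟩, fun R hR => ?_⟩
    obtain ⟨t, ht, -⟩ := key R hR
    simpa using List.ne_nil_of_mem ht
  · intro v hv
    obtain ⟨τ, hτ, hs⟩ := exists_mem_matchings (facts := facts) (θ := θ) k (As := v.2.dedup)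
      fun A hA => hθ A (hvs v hv (List.mem_dedup.1 hA))
    have hs' : Solves θ (τ.filter fun p => v.1.any fun x => decide (p.1 = Term.var x)) :=
      fun p hp => hs p (List.mem_of_mem_filter hp)
    refine ⟨_, ?_, hs'⟩
    rw [vertexRel, List.mem_filter]
    refine ⟨List.mem_map_of_mem hτ, ?_⟩
    simp only [Bool.and_eq_true, List.all_eq_true, List.any_eq_true, decide_eq_true_eq]
    refine ⟨consistent_iff.2 ⟨θ, solves_append.2 ⟨hs', hσ⟩⟩, fun A hA => ⟨_, hθ A hA, rfl, ?_⟩⟩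
    exact consistent_iff.2 ⟨θ, solves_append.2 ⟨(solves_zip_iff rfl (by simp [Atom.subst])).2 rfl,
      hs'⟩⟩

/-- In a tree, compatible elements can be chosen from the root downwards. -/
theorem Hypertree.exists_choice {H : Hypertree} {T : Type} (R : H.Vertex → Set T)
    (ok : T → T → Prop) (hR : ∀ p, (R p).Nonempty)
    (hok : ∀ p q, p < q → ∀ t ∈ R p, ∃ t' ∈ R q, ok t t') :
    ∃ τ : H.Vertex → T, ∀ p, τ p ∈ R p ∧ (p ≠ 0 → ok (τ (H.parent p)) (τ p)) := by
  -- Induction along the numbering: the parent of vertex `m` has a smaller number, so its element is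
  -- already fixed when the one at `m` is chosen.
  have key : ∀ m : ℕ, ∃ τ : H.Vertex → T, ∀ p : H.Vertex, p.val < m →
      τ p ∈ R p ∧ (p ≠ 0 → ok (τ (H.parent p)) (τ p)) := by
    intro m
    induction m with
    | zero => exact ⟨fun p => (hR p).some, fun p hp => absurd hp (Nat.not_lt_zero _)⟩
    | succ m ih =>
      obtain ⟨τ, hτ⟩ := ih
      by_cases hm : m < H.n + 1
      · let q : H.Vertex := ⟨m, hm⟩
        have hq : ∃ t ∈ R q, q ≠ 0 → ok (τ (H.parent q)) t := by
          by_cases h0 : q = 0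
          · exact ⟨(hR q).some, (hR q).some_mem, fun h => absurd h0 h⟩
          · have hlt := H.parent_lt q h0
            obtain ⟨t, ht, ht'⟩ := hok _ _ hlt _ (hτ (H.parent q) hlt).1
            exact ⟨t, ht, fun _ => ht'⟩
        obtain ⟨t, ht, ht'⟩ := hq
        refine ⟨Function.update τ q t, fun p hp => ?_⟩
        by_cases hpq : p = q
        · rw [hpq]
          refine ⟨by simpa using ht, fun h0 => ?_⟩
          rw [Function.update_self, Function.update_of_ne (H.parent_lt q h0).ne]
          exact ht' h0
        · have hp' : p.val < m := by
            have : p.val ≠ m := fun h => hpq (Fin.ext h)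
            lia
          rw [Function.update_of_ne hpq]
          refine ⟨(hτ p hp').1, fun h0 => ?_⟩
          have hlt : (H.parent p).val < p.val := H.parent_lt p h0
          rw [Function.update_of_ne (fun h => by
            have := congrArg Fin.val h
            simp only [q] at this
            lia)]
          exact (hτ p hp').2 h0
      · exact ⟨τ, fun p hp => hτ p (by have := p.isLt; lia)⟩
  obtain ⟨τ, hτ⟩ := key (H.n + 1)
  exact ⟨τ, fun p => hτ p p.isLt⟩

/-- The tuples chosen downwards from the root agree on each edge; connectedness spreads the
agreement over the tree, and the covering condition turns the glued substitution into a solution of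
the body. -/
theorem exists_solves_of_satisfiable {k : ℕ} {facts : List Fact} {Q : Query} {H : Hypertree}
    (hlen : ∀ A ∈ Q.body, ∀ f ∈ facts, A.rel = f.rel → A.args.length = f.args.length)
    (hH : H.IsDecomposition Q) (hk : H.width ≤ k) {σ : List (Term × ℕ)}
    (h : satisfiable k facts Q.body H.labels σ) :
    ∃ θ, (∀ A ∈ Q.body, A.subst θ ∈ facts) ∧ Solves θ σ := by
  simp only [satisfiable, Bool.and_eq_true, List.all_eq_true] at h
  obtain ⟨hσ, hne⟩ := h
  set Rs := semijoins (vertexRel k facts Q.body σ) (fun τ τ' => consistent (τ ++ τ')) H.labels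
    with hRs
  have hlab : H.labels.length = H.n + 1 := by simp [Hypertree.labels]
  have hRl : Rs.length = H.n + 1 := by rw [hRs, length_semijoins, hlab]
  obtain ⟨τ, hτ⟩ := H.exists_choice (fun p => {τ | τ ∈ Rs[p.val]'(by rw [hRl]; exact p.isLt)})
    (fun τ τ' => consistent (τ ++ τ'))
    (fun p => by
      obtain ⟨t, ht⟩ := List.exists_mem_of_ne_nil (Rs[p.val]'(by rw [hRl]; exact p.isLt))
        (by simpa using hne _ (List.getElem_mem (by rw [hRl]; exact p.isLt)))
      exact ⟨t, ht⟩)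
    (fun p q hpq => List.pairwise_iff_getElem.1 (pairwise_semijoins _ _ _) _ _
      (by rw [← hRs, hRl]; exact p.isLt) (by rw [← hRs, hRl]; exact q.isLt) hpq)
  have hmem : ∀ p, τ p ∈ vertexRel k facts Q.body σ (H.chiList p, H.lamList p) := by
    intro p
    have := getElem_semijoins_subset (vertexRel k facts Q.body σ)
      (fun τ τ' => consistent (τ ++ τ')) H.labels p (by rw [hlab]; exact p.isLt) (hτ p).1
    simp only [Hypertree.labels, List.getElem_ofFn] at this
    exact this
  have hrel : ∀ p, consistent (τ p ++ σ) ∧ (∀ A ∈ Q.body, ∃ f ∈ facts, A.rel = f.rel ∧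
      consistent (A.args.zip f.args ++ τ p)) ∧
      ∃ τ₀ ∈ matchings facts k (H.lamList p).dedup,
        ∀ t v, (t, v) ∈ τ p ↔ (t, v) ∈ τ₀ ∧ ∃ x ∈ H.chi p, t = .var x := by
    intro p
    have := hmem p
    rw [vertexRel, List.mem_filter, List.mem_map] at this
    simp only [Bool.and_eq_true, List.all_eq_true, List.any_eq_true, decide_eq_true_eq] at this
    obtain ⟨⟨τ₀, h₀, h₁⟩, h₂, h₃⟩ := this
    refine ⟨h₂, h₃, τ₀, h₀, fun t v => ?_⟩
    rw [← h₁]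
    simp [Hypertree.chi]
  -- A variable of χ(p) occurs in an atom of λ(p), and the matching gives that atom a fact. The
  -- width bound enters here: after `dedup` the list has at most `k` atoms, so none is skipped.
  have hcov : ∀ p, ∀ x ∈ H.chi p, ∃ v, (Term.var x, v) ∈ τ p := by
    intro p x hx
    obtain ⟨-, -, τ₀, h₀, h₁⟩ := hrel p
    have h₂ := hH.chi_subset p hx
    simp only [Hypertree.lamVars, Set.mem_iUnion] at h₂
    obtain ⟨A, hA, hxA⟩ := h₂
    have hcard : (H.lamList p).dedup.length ≤ k := by
      rw [← List.card_toFinset]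
      exact (Finset.le_sup (f := fun p => (H.lam p).card) (Finset.mem_univ p)).trans hk
    have hAl : A ∈ H.lamList p := by simpa [Hypertree.lam] using hA
    obtain ⟨f, hf, hr, hs⟩ := exists_of_mem_matchings hcard h₀ (List.mem_dedup.2 hAl)
    have hAQ : A ∈ Q.body := by simpa [Query.atoms] using (hH.isHypertree p).2 hA
    obtain ⟨i, hi, hix⟩ := List.getElem_of_mem (show Term.var x ∈ A.args from hxA)
    have hif : i < f.args.length := by rw [← hlen A hAQ f hf hr]; exact hi
    refine ⟨f.args[i], (h₁ _ _).2 ⟨hs ?_, x, hx, rfl⟩⟩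
    rw [← hix, ← List.getElem_zip (h := by simp [hi, hif])]
    exact List.getElem_mem _
  have hchi : ∀ p t v, (t, v) ∈ τ p → ∃ x ∈ H.chi p, t = .var x := by
    intro p t v htv
    obtain ⟨-, -, τ₀, h₀, h₁⟩ := hrel p
    exact ((h₁ t v).1 htv).2
  have huniq : ∀ {l l' : List (Term × ℕ)}, consistent (l ++ l') → ∀ {t v w}, (t, v) ∈ l →
      (t, w) ∈ l' → v = w := by
    intro l l' hl t v w hv hw
    obtain ⟨θ, hθ⟩ := consistent_iff.1 hl
    exact (hθ _ (List.mem_append_left _ hv)).symm.trans (hθ _ (List.mem_append_right _ hw))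
  -- Doubling a consistent list lets `huniq` say that a single tuple gives a term only one value.
  have hself : ∀ {l l' : List (Term × ℕ)}, consistent (l ++ l') → consistent (l ++ l) := by
    intro l l' hl
    obtain ⟨θ, hθ⟩ := consistent_iff.1 hl
    exact consistent_iff.2 ⟨θ, solves_append.2 ⟨(solves_append.1 hθ).1, (solves_append.1 hθ).1⟩⟩
  have hagree : ∀ p q x v w, (Term.var x, v) ∈ τ p → (Term.var x, w) ∈ τ q → v = w := by
    intro p q x v w hv hw
    have hxp : x ∈ H.chi p := by obtain ⟨y, hy, h⟩ := hchi _ _ _ hv; cases h; exact hy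
    have hxq : x ∈ H.chi q := by obtain ⟨y, hy, h⟩ := hchi _ _ _ hw; cases h; exact hy
    have hreach := hH.connected x ((hH.isHypertree p).1 x hxp) ⟨p, hxp⟩ ⟨q, hxq⟩
    rw [SimpleGraph.reachable_iff_reflTransGen] at hreach
    -- The value `v` travels along a path of vertices that contain `x`: the next vertex gives `x`
    -- some value by `hcov`, and compatibility along the edge, in whichever direction it points,
    -- forces this value to be `v`.
    have hall : ∀ r : {p | x ∈ H.chi p}, Relation.ReflTransGen
        (H.graph.induce {p | x ∈ H.chi p}).Adj ⟨p, hxp⟩ r → (Term.var x, v) ∈ τ r := by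
      intro r hr
      induction hr with
      | refl => exact hv
      | @tail b c _ hbc ih =>
        obtain ⟨u, hu⟩ := hcov c x c.2
        have hadj : H.graph.Adj b c := hbc
        rw [Hypertree.graph, SimpleGraph.fromRel_adj] at hadj
        obtain ⟨hne, hbc | hcb⟩ := hadj
        · have h0 : b.val ≠ 0 := fun h0 => hne (by rw [← hbc, h0, H.parent_root])
          have := (hτ b).2 h0
          rw [hbc] at this
          rwa [← huniq this hu ih]
        · have h0 : c.val ≠ 0 := fun h0 => hne (by rw [← hcb, h0, H.parent_root])
          have := (hτ c).2 h0
          rw [hcb] at this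
          rwa [huniq this ih hu]
    exact huniq (hself (hrel q).1) (hall _ hreach) hw
  -- Gluing: `σ` is consistent by the test, with each tuple by the filter in `vertexRel`, and the
  -- tuples are consistent with each other by `hagree`.
  obtain ⟨θ, hθ⟩ : ∃ θ, Solves θ (σ ++ (List.ofFn τ).flatten) := by
    rw [← consistent_iff]
    simp only [consistent, List.all_eq_true, Bool.and_eq_true, Bool.or_eq_true, Bool.not_eq_true',
      decide_eq_false_iff_not, decide_eq_true_eq, List.mem_append, List.mem_flatten, List.mem_ofFn,
      exists_exists_eq_and]
    have hσ' := hσ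
    simp only [consistent, List.all_eq_true, Bool.and_eq_true, Bool.or_eq_true, Bool.not_eq_true',
      decide_eq_false_iff_not, decide_eq_true_eq] at hσ'
    have himp : ∀ {a b : Prop}, (a → b) → ¬a ∨ b := fun h => not_or_of_imp h
    rintro ⟨t, v⟩ (h | ⟨p, h⟩)
    · refine ⟨(hσ' _ h).1, ?_⟩
      rintro ⟨s, w⟩ (h' | ⟨q, h'⟩)
      · exact (hσ' _ h).2 _ h'
      · refine himp ?_
        rintro rfl
        exact (huniq (hrel q).1 h' h).symm
    · obtain ⟨x, hx, rfl⟩ := hchi _ _ _ h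
      refine ⟨.inl rfl, ?_⟩
      rintro ⟨s, w⟩ (h' | ⟨q, h'⟩)
      · refine himp ?_
        rintro rfl
        exact huniq (hrel p).1 h h'
      · refine himp ?_
        rintro rfl
        exact hagree p q x v w h h'
  rw [solves_append] at hθ
  refine ⟨θ, fun A hA => ?_, hθ.1⟩
  -- At a vertex covering `A` the tuple fixes all variables of `A`, so the fact `f` found by the
  -- filter for `A` can only be `Aθ`.
  obtain ⟨p, hp⟩ := hH.covers A (by simpa [Query.atoms] using hA)
  obtain ⟨f, hf, hr, hc⟩ := (hrel p).2.1 A hA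
  obtain ⟨θ', hθ'⟩ := consistent_iff.1 hc
  rw [solves_append] at hθ'
  have : A.subst θ = f := by
    rw [← solves_zip_iff hr (hlen A hA f hf hr)]
    rintro ⟨t, v⟩ htv
    rw [← hθ'.1 _ htv]
    cases t with
    | const c => rfl
    | var x =>
      have hx : x ∈ H.chi p := hp (List.of_mem_zip htv).1
      obtain ⟨w, hw⟩ := hcov p x hx
      exact (hθ.2 _ (List.mem_flatten.2 ⟨_, List.mem_ofFn.2 ⟨p, rfl⟩, hw⟩)).trans (hθ'.2 _ hw).symm
  rw [this]
  exact hf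

/-! ### Enumeration of the answer tuples -/

/-- The values that a term may take. -/
def termValues (dom : List ℕ) (t : Term) : List ℕ := if t.isVar then dom.dedup else [t.name]

/-- The evaluations of a list of terms, built up from its end, that satisfy a test. -/
def evaluations (test : List (Term × ℕ) → Bool) (dom : List ℕ) (ts : List Term) :
    List (List (Term × ℕ)) :=
  ts.foldr (fun t L => L.flatMap fun σ => ((termValues dom t).map fun v => (t, v) :: σ).filter test)
    (if test [] then [[]] else [])

theorem evaluations_cons (test : List (Term × ℕ) → Bool) (dom : List ℕ) (t : Term)
    (ts : List Term) : evaluations test dom (t :: ts) = (evaluations test dom ts).flatMap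
      fun σ => ((termValues dom t).map fun v => (t, v) :: σ).filter test := rfl

/-- The test on the whole list makes all its entries come from one `θ` with `P θ`; in particular,
repeated variables get equal values and constants their own. -/
theorem mem_evaluations {test : List (Term × ℕ) → Bool} {P : (ℕ → ℕ) → Prop}
    (htest : ∀ σ, test σ ↔ ∃ θ, P θ ∧ Solves θ σ) {dom : List ℕ} {ts : List Term}
    {σ : List (Term × ℕ)} : σ ∈ evaluations test dom ts ↔
      ∃ θ, P θ ∧ (∀ x ∈ varsOf ts, θ x ∈ dom) ∧ σ = ts.map fun t => (t, t.subst θ) := by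
  induction ts generalizing σ with
  | nil =>
    have := htest []
    by_cases h : test [] <;> simp_all [evaluations, varsOf, Solves]
  | cons t ts ih =>
    rw [evaluations_cons, List.mem_flatMap]
    simp only [List.mem_filter, List.mem_map]
    constructor
    · rintro ⟨σ', h', ⟨v, hv, rfl⟩, ht⟩
      obtain ⟨θ', -, hd, rfl⟩ := ih.1 h'
      -- `θ'` belongs to the shorter list and `θ` to the extended one. They agree on `ts`, so the
      -- domain condition passes from `θ'` to `θ`.
      obtain ⟨θ, hP, hs⟩ := (htest _).1 ht
      have h₁ : t.subst θ = v := hs (t, v) (by simp)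
      have h₂ : ∀ s ∈ ts, s.subst θ = s.subst θ' := fun s hms =>
        hs (s, s.subst θ') (List.mem_cons_of_mem _ (List.mem_map.2 ⟨s, hms, rfl⟩))
      refine ⟨θ, hP, fun x hx => ?_, ?_⟩
      · rcases List.mem_cons.1 hx with rfl | hx
        · simpa [termValues, Term.isVar, ← h₁, Term.subst] using hv
        · have := h₂ _ hx
          simp only [Term.subst] at this
          rw [this]
          exact hd x hx
      · simp only [List.map_cons, h₁, List.cons.injEq, true_and]
        exact List.map_congr_left fun s hms => by rw [h₂ s hms]
    · rintro ⟨θ, hP, hd, rfl⟩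
      refine ⟨ts.map fun t => (t, t.subst θ),
        ih.2 ⟨θ, hP, fun x hx => hd x (List.mem_cons_of_mem _ hx), rfl⟩, ⟨t.subst θ, ?_, rfl⟩,
        (htest _).2 ⟨θ, hP, ?_⟩⟩
      · cases t with
        | const c => simp [termValues, Term.isVar, Term.name, Term.subst]
        | var x => simpa [termValues, Term.isVar, Term.subst] using hd x (by simp [varsOf])
      · intro p hp
        obtain ⟨s, -, rfl⟩ := List.mem_map.1
          (show p ∈ (t :: ts).map fun t => (t, t.subst θ) from hp)
        rfl

theorem nodup_termValues (dom : List ℕ) (t : Term) : (termValues dom t).Nodup := by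
  unfold termValues
  split
  · exact List.nodup_dedup _
  · exact List.nodup_singleton _

/-- Extensions of different assignments differ in their tails, those of the same assignment in the
new value; hence the `dedup` in `termValues`. -/
theorem nodup_evaluations (test : List (Term × ℕ) → Bool) (dom : List ℕ) (ts : List Term) :
    (evaluations test dom ts).Nodup := by
  induction ts with
  | nil =>
    simp only [evaluations, List.foldr_nil]
    split <;> simp
  | cons t ts ih =>
    rw [evaluations_cons, List.nodup_flatMap]
    refine ⟨fun σ _ => .filter _ ((nodup_termValues dom t).map fun v w h => by simpa using h),
      ih.imp fun {σ σ'} hne => ?_⟩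
    intro ρ h h'
    simp only [List.mem_filter, List.mem_map] at h h'
    obtain ⟨⟨v, -, rfl⟩, -⟩ := h
    obtain ⟨⟨w, -, h⟩, -⟩ := h'
    simp only [List.cons.injEq] at h
    exact hne h.2.symm

/-- The answer tuples. -/
def answerList (test : List (Term × ℕ) → Bool) (dom : List ℕ) (ts : List Term) :
    List (List ℕ) := (evaluations test dom ts).map fun σ => σ.map Prod.snd

/-- The test does not mention the universe. For body variables this is harmless, as their values
occur in facts; for head variables `termValues` enforces it. The terms being fixed, a tuple
determines its evaluation, so none is repeated. -/
theorem enumerates_answerList {test : List (Term × ℕ) → Bool} {DB : Database} {Q : Query}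
    {S : Schema} (hDB : DB.IsOver S)
    (htest : ∀ σ, test σ ↔ ∃ θ, (∀ A ∈ Q.body, A.subst θ ∈ DB.facts) ∧ Solves θ σ) :
    Enumerates (answerList test DB.dom Q.head) (Q.answer DB) := by
  constructor
  · refine List.Nodup.map_on ?_ (nodup_evaluations _ _ _)
    intro σ hσ σ' hσ' h
    obtain ⟨θ, -, -, rfl⟩ := (mem_evaluations htest).1 hσ
    obtain ⟨θ', -, -, rfl⟩ := (mem_evaluations htest).1 hσ'
    simp only [List.map_map, List.map_inj_left, Function.comp] at h
    exact List.map_congr_left fun t ht => by rw [h t ht]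
  · intro t
    simp only [answerList, List.mem_map, mem_evaluations htest, Query.answer, Set.mem_ofPred_eq]
    constructor
    · rintro ⟨σ, ⟨θ, hθ, hd, rfl⟩, rfl⟩
      refine ⟨θ, ?_, fun A hA => hθ A (by simpa [Query.atoms] using hA), by simp⟩
      rintro x (hx | hx)
      · exact hd x hx
      · simp only [Set.mem_iUnion] at hx
        obtain ⟨A, hA, hx⟩ := hx
        refine (hDB _ (hθ A (by simpa [Query.atoms] using hA))).2.2 _ ?_
        exact List.mem_map.2 ⟨_, hx, rfl⟩
    · rintro ⟨θ, hd, hθ, rfl⟩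
      exact ⟨_, ⟨θ, fun A hA => hθ A (by simpa [Query.atoms] using hA),
        fun x hx => hd x (.inl hx), rfl⟩, by simp⟩

/-- No intermediate result has more than one element more than the answer. -/
theorem length_evaluations_le {test : List (Term × ℕ) → Bool} {DB : Database} {Q : Query}
    {S : Schema} (hDB : DB.IsOver S)
    (htest : ∀ σ, test σ ↔ ∃ θ, (∀ A ∈ Q.body, A.subst θ ∈ DB.facts) ∧ Solves θ σ)
    (us ts : List Term) : (evaluations test DB.dom ts).length ≤
      (evaluations test DB.dom (us ++ ts)).length + 1 := by
  -- Over an empty universe a variable has no value and a constant has one, so no list exceeds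
  -- length 1, while the answer may be empty. This accounts for the summand 1.
  rcases hdom : DB.dom with - | ⟨d, ds⟩
  · have : ∀ ts, (evaluations test [] ts).length ≤ 1 := by
      intro ts
      induction ts with
      | nil =>
        simp only [evaluations, List.foldr_nil]
        split <;> simp
      | cons t ts ih =>
        rw [evaluations_cons, List.length_flatMap]
        refine (List.sum_le_card_nsmul _ 1 ?_).trans (by simpa using ih)
        simp only [List.mem_map]
        rintro _ ⟨σ, -, rfl⟩
        refine (List.length_filter_le _ _).trans ?_
        cases t <;> simp [termValues, Term.isVar]
    exact (this ts).trans (Nat.le_add_left _ _)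
  · rw [← hdom]
    refine le_trans ?_ (Nat.le_add_right _ _)
    induction us with
    | nil => rfl
    | cons u us ih =>
      refine ih.trans ?_
      rw [List.cons_append, evaluations_cons, List.length_flatMap]
      refine le_trans (by simp) (List.card_nsmul_le_sum _ 1 ?_)
      simp only [List.mem_map]
      rintro _ ⟨σ, hσ, rfl⟩
      rw [Nat.one_le_iff_ne_zero, Ne, List.length_eq_zero_iff, ← Ne]
      obtain ⟨θ, hθ, hd, rfl⟩ := (mem_evaluations htest).1 hσ
      obtain ⟨θ', hθ', hd', hs'⟩ : ∃ θ', (∀ A ∈ Q.body, A.subst θ' ∈ DB.facts) ∧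
          (∀ x ∈ varsOf (u :: (us ++ ts)), θ' x ∈ DB.dom) ∧
          ∀ t ∈ us ++ ts, t.subst θ' = t.subst θ := by
        -- The substitution from the test may send `u` outside the universe. Then the variable `u`
        -- occurs neither in the body, by `hDB`, nor in the later terms, and can be moved to the
        -- element `d`.
        by_cases hu : ∀ x, u = .var x → θ x ∈ DB.dom
        · refine ⟨θ, hθ, fun x hx => ?_, fun _ _ => rfl⟩
          rcases List.mem_cons.1 hx with h | h
          · exact hu x h.symm
          · exact hd x h
        · push Not at hu
          obtain ⟨x, rfl, hx⟩ := hu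
          have hsub : ∀ t : Term, t ≠ .var x →
              t.subst (Function.update θ x d) = t.subst θ := by
            rintro (y | c) hy
            · exact Function.update_of_ne (fun h => hy (by rw [h])) _ _
            · rfl
          refine ⟨Function.update θ x d, fun A hA => ?_, fun y hy => ?_, fun t ht => hsub t ?_⟩
          · have : A.subst (Function.update θ x d) = A.subst θ := by
              simp only [Atom.subst, Fact.mk.injEq, true_and]
              refine List.map_congr_left fun t ht => hsub t ?_
              rintro rfl
              exact hx ((hDB _ (hθ A hA)).2.2 _ (List.mem_map.2 ⟨_, ht, rfl⟩))
            rw [this]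
            exact hθ A hA
          · by_cases hyx : y = x
            · subst hyx
              simp [hdom]
            · rw [Function.update_of_ne hyx]
              rcases List.mem_cons.1 hy with h | h
              · cases h
                exact absurd rfl hyx
              · exact hd y h
          · rintro rfl
            exact hx (hd x ht)
      have hmem : (u :: (us ++ ts)).map (fun t => (t, t.subst θ')) ∈
          evaluations test DB.dom (u :: (us ++ ts)) :=
        (mem_evaluations htest).2 ⟨θ', hθ', hd', rfl⟩
      rw [evaluations_cons, List.mem_flatMap] at hmem
      obtain ⟨σ', -, h⟩ := hmem
      have h' := h
      rw [List.mem_filter, List.mem_map] at h'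
      obtain ⟨⟨v, -, hv⟩, -⟩ := h'
      simp only [List.map_cons, List.cons.injEq] at hv
      refine List.ne_nil_of_mem (a := (u :: (us ++ ts)).map fun t => (t, t.subst θ')) ?_
      have hm : (us ++ ts).map (fun t => (t, t.subst θ)) =
          (us ++ ts).map fun t => (t, t.subst θ') :=
        List.map_congr_left fun t ht => by rw [hs' t ht]
      rw [hv.2] at h
      rwa [hm]

end ConjQuery

/-! ### Representation of query data, and polynomial time for the evaluation -/

namespace StackProgram

open Coded

/-- Types whose representation is faithful. -/
class CodedInj (α : Type) [Coded α] : Prop where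
  enc_injective : Function.Injective (enc : α → Data)

/-- Types whose weight is the size of the representation. -/
class CodedExact (α : Type) [Coded α] : Prop where
  wt_le_size : ∀ a : α, wt a ≤ (enc a).size

/-- The list with the given representation. -/
def asList : Data → List Data
  | .nil => []
  | .node x y => x :: asList y

@[simp] theorem enc_data (x : Data) : enc x = x := rfl

@[simp] theorem enc_asList (x : Data) : enc (asList x) = x := by
  induction x with
  | nil => rfl
  | node x y _ ih => simp [asList, ih]

@[simp] theorem asList_node (x y : Data) : asList (.node x y) = x :: asList y := rfl

@[simp] theorem asList_nil : asList .nil = [] := rfl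

@[simp] theorem asList_enc {α : Type} [Coded α] (l : List α) : asList (enc l) = l.map enc := by
  induction l with
  | nil => rfl
  | cons x l ih => simp [ih]

@[simp] theorem enc_map_enc {α : Type} [Coded α] (l : List α) : enc (l.map enc) = enc l := by
  rw [← asList_enc, enc_asList]

instance : CodedInj Data := ⟨fun _ _ h => h⟩

instance : CodedExact Data := ⟨fun _ => le_rfl⟩

instance : CodedInj Bool := ⟨by decide⟩

instance {α : Type} [Coded α] [CodedInj α] : CodedInj (List α) := ⟨fun l l' h => by
  have := congrArg asList h
  rw [asList_enc, asList_enc] at this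
  exact List.map_injective_iff.2 CodedInj.enc_injective this⟩

theorem size_enc_list_cons {α : Type} [Coded α] (x : α) (l : List α) :
    (enc (x :: l)).size = (enc x).size + (enc l).size + 1 := rfl

instance {α : Type} [Coded α] [CodedExact α] : CodedExact (List α) := ⟨fun l => by
  induction l with
  | nil => simp [Data.size]
  | cons x l ih =>
    have := CodedExact.wt_le_size x
    rw [wt_list_cons, size_enc_list_cons]
    lia⟩

instance {α β : Type} [Coded α] [Coded β] [CodedExact α] [CodedExact β] : CodedExact (α × β) :=
  ⟨fun p => by
    have := CodedExact.wt_le_size p.1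
    have := CodedExact.wt_le_size p.2
    rw [wt_prod, enc_prod, Data.size]
    lia⟩

/-- Represents a type like another one. -/
abbrev Coded.ofMap {α β : Type} [Coded β] (f : α → β) : Coded α where
  enc a := enc (f a)
  wt a := (enc (f a)).size
  size_enc_le _ := le_rfl

section

variable {α β γ : Type} [Coded α] [Coded β] [Coded γ]

@[fun_prop]
theorem PT.decide_eq [DecidableEq β] [CodedInj β] {f g : α → β} (hf : PT f) (hg : PT g) :
    PT fun a => decide (f a = g a) := by
  simpa only [CodedInj.enc_injective.eq_iff] using hf.eq_enc hg

theorem PT.congr {f g : α → β} (hf : PT f) (h : ∀ a, g a = f a) : PT g := by rwa [funext h]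

/-- The representation as a function. -/
theorem PT.toData {f : α → β} (hf : PT f) : PT fun a => Coded.enc (f a) := by
  obtain ⟨_, q, h⟩ := id hf
  exact hf.congr_enc (fun _ => rfl) q fun a => (size_enc_le _).trans (h a).1

/-- When the weight is the size of the representation, computing the representation suffices. This
is how components are read out of records. -/
theorem PT.of_enc [CodedExact γ] {f : α → Data} {g : α → γ} (hf : PT f)
    (h : ∀ a, Coded.enc (g a) = f a) : PT g := by
  obtain ⟨_, q, hq⟩ := id hf
  refine hf.congr_enc h q fun a => (CodedExact.wt_le_size _).trans ?_
  rw [h]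
  exact (hq a).1

@[fun_prop]
theorem PT.asList {f : α → Data} (hf : PT f) : PT fun a => asList (f a) :=
  hf.of_enc fun _ => enc_asList _

@[fun_prop]
theorem PT.node {f g : α → Data} (hf : PT f) (hg : PT g) : PT fun a => Data.node (f a) (g a) :=
  .of_enc (hf.pair hg).toData fun _ => rfl

@[fun_prop]
theorem PT.headD {f : α → List β} (d : β) (hf : PT f) : PT fun a => (f a).headD d := by
  have h : PT fun a => match f a with
      | [] => d
      | x :: _ => x := .listCase hf (by fun_prop) (by fun_prop)
  have h' : ∀ l : List β, l.headD d = match l with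
      | [] => d
      | x :: _ => x := fun l => by cases l <;> rfl
  simpa only [h'] using h

@[fun_prop]
theorem PT.tail {f : α → List β} (hf : PT f) : PT fun a => (f a).tail := by
  have h : PT fun a => match f a with
      | [] => []
      | _ :: l => l := .listCase hf (by fun_prop) (by fun_prop)
  have h' : ∀ l : List β, l.tail = match l with
      | [] => []
      | _ :: l => l := fun l => by cases l <;> rfl
  simpa only [h'] using h

@[fun_prop]
theorem PT.dedup [DecidableEq β] [CodedInj β] {f : α → List β} (hf : PT f) :
    PT fun a => (f a).dedup := by
  have h : PT fun a => (f a).foldr (fun x l => if l.any fun y => decide (y = x) then l else x :: l)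
      [] := by
    refine .foldr (init := fun _ => [])
      (step := fun _ x l => if l.any fun y => decide (y = x) then l else x :: l) hf
      (by fun_prop) ?_ (Polynomial.X + 1) fun _ x s => ?_
    · refine .ite ?_ ?_ ?_
      rotate_left
      · fun_prop
      · fun_prop
      exact .any (f := fun p : α × β × List β => p.2.2) (by fun_prop) (by fun_prop)
    · split
      · exact Nat.le_add_right _ _
      · simp; lia
  have h' : ∀ l : List β, l.dedup =
      l.foldr (fun x l => if l.any fun y => decide (y = x) then l else x :: l) [] := by
    intro l
    induction l with
    | nil => rfl
    | cons x l ih =>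
      rw [List.foldr_cons, ← ih]
      by_cases hx : x ∈ l <;> simp [hx]
  simpa only [h'] using h

end

/-- The `i`-th component of a record. -/
def component (i : ℕ) (d : Data) : Data := ((asList d).drop i).headD .nil

@[fun_prop]
theorem PT.component (i : ℕ) : PT fun d => component i d := by
  have h : ∀ i, PT fun d => (StackProgram.asList d).drop i := by
    intro i
    induction i with
    | zero => simpa using PT.asList .identity
    | succ i ih =>
      simpa only [List.tail_drop] using PT.tail ih
  exact .headD _ (h i)

open ConjQuery

instance : Coded ℕ := .ofMap Computability.encodeNat

instance : CodedExact ℕ := ⟨fun _ => le_rfl⟩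

theorem encodeNat_injective : Function.Injective Computability.encodeNat :=
  Function.LeftInverse.injective Computability.decode_encodeNat

instance : CodedInj ℕ := ⟨fun _ _ h => encodeNat_injective (CodedInj.enc_injective h)⟩

/-- A term as a word of bits. -/
def _root_.ConjQuery.Term.bits (t : Term) : List Bool := (!t.isVar) :: Computability.encodeNat t.name

instance : Coded Term := .ofMap Term.bits

instance : CodedExact Term := ⟨fun _ => le_rfl⟩

instance : CodedInj Term := ⟨fun s t h => by
  have h' : s.bits = t.bits := CodedInj.enc_injective h
  rw [Term.bits, Term.bits, List.cons.injEq] at h'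
  have h₂ := encodeNat_injective h'.2
  have h₁ := h'.1
  cases s <;> cases t <;> simp_all [Term.isVar, Term.name]⟩

instance : Coded Fact := .ofMap fun f => [enc f.rel, enc f.args]

instance : CodedExact Fact := ⟨fun _ => le_rfl⟩

instance : Coded Atom := .ofMap fun A => [enc A.rel, enc A.args]

instance : CodedExact Atom := ⟨fun _ => le_rfl⟩

instance : CodedInj Atom := ⟨fun A B h => by
  have h' : [enc A.rel, enc A.args] = [enc B.rel, enc B.args] := CodedInj.enc_injective h
  simp only [List.cons.injEq, and_true, CodedInj.enc_injective.eq_iff] at h'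
  obtain ⟨r, ts⟩ := A
  obtain ⟨r', ts'⟩ := B
  simp_all⟩

@[fun_prop]
theorem PT.isVar : PT fun t : Term => t.isVar := by
  have h : PT fun t : Term => decide (StackProgram.component 0 (enc t) = enc false) :=
    .decide_eq ((PT.component 0).comp (PT.toData .identity)) (by fun_prop)
  refine h.congr_enc (fun t => ?_) 3 (by simp)
  cases t
  · exact congrArg enc (decide_eq_true rfl).symm
  · exact congrArg enc (decide_eq_false fun h => by cases h).symm

@[fun_prop]
theorem PT.name : PT fun t : Term => t.name := by
  have h : PT fun t : Term => (StackProgram.asList (enc t)).tail :=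
    .tail (.asList (PT.toData .identity))
  refine .of_enc h.toData fun t => ?_
  rw [show StackProgram.asList (enc t) = t.bits.map enc from asList_enc t.bits, Term.bits, List.map_cons,
    List.tail_cons, enc_map_enc]
  rfl

@[fun_prop]
theorem PT.var : PT fun x : ℕ => Term.var x := by
  have h : PT fun x : ℕ => Data.node (enc false) (enc x) := .node (by fun_prop) (PT.toData .identity)
  exact h.of_enc fun x => rfl

@[fun_prop]
theorem PT.factRel : PT fun f : Fact => f.rel :=
  .of_enc ((PT.component 0).comp (PT.toData .identity)) fun _ => rfl

@[fun_prop]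
theorem PT.factArgs : PT fun f : Fact => f.args :=
  .of_enc ((PT.component 1).comp (PT.toData .identity)) fun _ => rfl

@[fun_prop]
theorem PT.atomRel : PT fun A : Atom => A.rel :=
  .of_enc ((PT.component 0).comp (PT.toData .identity)) fun _ => rfl

@[fun_prop]
theorem PT.atomArgs : PT fun A : Atom => A.args :=
  .of_enc ((PT.component 1).comp (PT.toData .identity)) fun _ => rfl

@[fun_prop]
theorem PT.consistent : PT fun l : List (Term × ℕ) => ConjQuery.consistent l := by
  unfold ConjQuery.consistent
  refine .all (by fun_prop) (.and (by fun_prop) ?_)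
  exact .all (by fun_prop) (by fun_prop)

/-- The recursion on `k` is unfolded into the program, which is therefore different for each `k`, as
is its polynomial. -/
theorem PT.matchings (k : ℕ) : PT fun p : List Fact × List Atom => ConjQuery.matchings p.1 k p.2 := by
  induction k with
  | zero => exact .const _
  | succ k ih =>
    refine (PT.listCase (f := fun p : List Fact × List Atom => p.2)
      (g := fun _ => ([[]] : List (List (Term × ℕ)))) (h := fun p A As => p.1.flatMap fun f : Fact =>
        if decide (A.rel = f.rel) then (ConjQuery.matchings p.1 k As).map fun τ =>
          A.args.zip f.args ++ τ else []) (by fun_prop) (by fun_prop) ?_).congr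
      fun ⟨_, As⟩ => by cases As <;> rfl
    refine .flatMap (by fun_prop) ?_
    refine .ite ?_ ?_ ?_
    · fun_prop
    rotate_left
    · fun_prop
    refine .map ?_ (by fun_prop)
    exact ih.comp (f := fun p : ((List Fact × List Atom) × Atom × List Atom) × Fact =>
      (p.1.1.1, p.1.2.2)) (by fun_prop)

section

variable {α β γ : Type} [Coded α] [Coded β] [Coded γ]

/-- Each round adds a sublist of `rel a v`, whose weight is bounded independently of the relations
collected so far, so the growth is additive. -/
theorem PT.semijoins {l : α → List β} {rel : α → β → List γ} {ok : γ → γ → Bool} (hl : PT l)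
    (hrel : PT fun p : α × β => rel p.1 p.2) (hok : PT fun p : γ × γ => ok p.1 p.2) :
    PT fun a => ConjQuery.semijoins (rel a) ok (l a) := by
  obtain ⟨_, q, hq⟩ := id hrel
  refine .foldr (step := fun a v Rs =>
    ((rel a v).filter fun t => Rs.all fun R => R.any fun t' => ok t t') :: Rs) hl (by fun_prop)
    ?_ (q.comp (Polynomial.X + 1) + 1) fun a v Rs => ?_
  · refine .cons (.filter ?_ (.all (by fun_prop) (.any (by fun_prop) ?_))) (by fun_prop)
    · exact hrel.comp (f := fun p : α × β × List (List γ) => (p.1, p.2.1)) (by fun_prop)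
    · exact hok.comp (f := fun p : (((α × β × List (List γ)) × γ) × List γ) × γ =>
        (p.1.1.2, p.2)) (by fun_prop)
  · have h₁ := (hq (a, v)).1
    have h₂ : ∀ (P : γ → Bool) (l : List γ), wt (l.filter P) ≤ wt l := by
      intro P l
      induction l with
      | nil => simp
      | cons x l ih =>
        rw [List.filter_cons]
        split <;> simp <;> lia
    have h₃ := h₂ (fun t => Rs.all fun R => R.any fun t' => ok t t') (rel a v)
    simp at h₁ ⊢
    lia

theorem PT.vertexRel (k : ℕ) {facts : α → List Fact} {body : α → List Atom}
    {σ : α → List (Term × ℕ)} {v : α → List ℕ × List Atom} (hf : PT facts) (hb : PT body)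
    (hσ : PT σ) (hv : PT v) : PT fun a => ConjQuery.vertexRel k (facts a) (body a) (σ a) (v a) := by
  unfold ConjQuery.vertexRel
  refine .filter (.map ?_ (.filter (by fun_prop) (.any (by fun_prop) (by fun_prop))))
    (.and (by fun_prop) (.all (by fun_prop) (.any (by fun_prop) (by fun_prop))))
  exact (PT.matchings k).comp (f := fun a => (facts a, (v a).2.dedup)) (by fun_prop)

theorem PT.satisfiable (k : ℕ) {facts : α → List Fact} {body : α → List Atom}
    {vs : α → List (List ℕ × List Atom)} {σ : α → List (Term × ℕ)} (hf : PT facts) (hb : PT body)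
    (hvs : PT vs) (hσ : PT σ) :
    PT fun a => ConjQuery.satisfiable k (facts a) (body a) (vs a) (σ a) := by
  unfold ConjQuery.satisfiable
  refine .and (by fun_prop) (.all (.semijoins hvs ?_ (by fun_prop)) (by fun_prop))
  exact .vertexRel k (by fun_prop) (by fun_prop) (by fun_prop) (by fun_prop)

theorem PT.termValues {dom : α → List ℕ} {t : α → Term} (hd : PT dom) (ht : PT t) :
    PT fun a => ConjQuery.termValues (dom a) (t a) := by
  unfold ConjQuery.termValues
  fun_prop

/-- Here a step can multiply the number of assignments, so a bound on all intermediate lists is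
assumed; for an `Input` it comes from the size of the answer. -/
theorem PT.evaluations {test : α → List (Term × ℕ) → Bool} {dom : α → List ℕ} {ts : α → List Term}
    (htest : PT fun p : α × List (Term × ℕ) => test p.1 p.2) (hd : PT dom) (ht : PT ts)
    (q : Polynomial ℕ) (hq : ∀ a us vs, ts a = us ++ vs →
      wt (ConjQuery.evaluations (test a) (dom a) vs) ≤ q.eval (wt a)) :
    PT fun a => ConjQuery.evaluations (test a) (dom a) (ts a) := by
  refine .foldr_of_bound (step := fun a t (L : List (List (Term × ℕ))) => L.flatMap fun σ =>
    ((ConjQuery.termValues (dom a) t).map fun v => (t, v) :: σ).filter (test a)) ht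
    (.ite (htest.comp (f := fun a => (a, [])) (by fun_prop)) (by fun_prop) (by fun_prop)) ?_ q hq
  refine .flatMap (by fun_prop) (.filter (.map (.termValues (by fun_prop) (by fun_prop))
    (by fun_prop)) ?_)
  exact htest.comp (f := fun p : ((α × Term × List (List (Term × ℕ))) × List (Term × ℕ)) ×
    List (Term × ℕ) => (p.1.1.1, p.2)) (by fun_prop)

theorem PT.answerList {test : α → List (Term × ℕ) → Bool} {dom : α → List ℕ} {ts : α → List Term}
    (htest : PT fun p : α × List (Term × ℕ) => test p.1 p.2) (hd : PT dom) (ht : PT ts)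
    (q : Polynomial ℕ) (hq : ∀ a us vs, ts a = us ++ vs →
      wt (ConjQuery.evaluations (test a) (dom a) vs) ≤ q.eval (wt a)) :
    PT fun a => ConjQuery.answerList (test a) (dom a) (ts a) :=
  .map (.evaluations htest hd ht q hq) (.map (by fun_prop) (by fun_prop))

end

end StackProgram

/-! ### Words: loading, unloading, parsing and writing -/

namespace StackProgram

open Coded

def comb : ℕ → Data
  | 0 => .nil
  | n + 1 => .node .nil (comb n)

def symIndex : Sym → ℕ
  | .bra => 0
  | .ket => 1
  | .comma => 2
  | .bit false => 3
  | .bit true => 4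
  | .blank => 5

instance : Coded Sym where
  enc x := comb (symIndex x)
  wt x := (comb (symIndex x)).size
  size_enc_le _ := le_rfl

instance : CodedInj Sym := ⟨by decide⟩

theorem wt_sym_le (x : Sym) : wt x ≤ 11 := by cases x with
  | bit b => cases b <;> decide
  | _ => decide

theorem wt_word_le (w : List Sym) : wt w ≤ 12 * w.length + 1 := by
  induction w with
  | nil => simp
  | cons x w ih =>
    have := wt_sym_le x
    simp
    lia

/-- Removes a comb from the top and pushes the corresponding symbol of the list on `r`. -/
def emit : List Sym → Prog
  | [] => .skip
  | x :: l => opCase (.push .r x) (.seq opDrop (emit l))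

theorem runs_emit (l : List Sym) (i : ℕ) (hi : i < l.length) (m r : List Sym) :
    Runs (emit l) (st ((comb i).code ++ m) r) (st m (l[i] :: r)) (11 * i + 2) := by
  induction l generalizing i with
  | nil => simp at hi
  | cons x l ih =>
    cases i with
    | zero =>
      refine (runs_case_nil (n := 1) ?_).mono (by lia)
      simpa [st] using Runs.push .r x (st m r)
    | succ i =>
      refine (runs_case_node ((runs_drop .nil _ r).seq (ih i (by simpa using hi)))).mono ?_
      simp [Data.size]
      lia

def symbols : List Sym := [.bra, .ket, .comma, .bit false, .bit true, .blank]

theorem runs_emit_symbols (x : Sym) (m r : List Sym) :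
    Runs (emit symbols) (st ((enc x).code ++ m) r) (st m (x :: r)) 57 := by
  have h : ∀ i (hi : i < symbols.length), symIndex x = i → symbols[i] = x →
      Runs (emit symbols) (st ((enc x).code ++ m) r) (st m (x :: r)) 57 := by
    intro i hi h₁ h₂
    have := runs_emit symbols i hi m r
    rw [h₂, ← h₁] at this
    refine this.mono ?_
    simp [symbols] at hi
    lia
  cases x with
  | bit b => cases b <;> exact h _ (by decide) rfl rfl
  | _ => exact h _ (by decide) rfl rfl

/-- Moves the word represented on top of `main` to `b`. -/
def unload : Prog := .seq (opWhile (emit symbols)) (pour .r .b)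

theorem runs_unload (w : List Sym) :
    Runs unload (st (enc w).code []) (mk [] [] w [] []) (62 * w.length + 6) := by
  have h : ∀ (w m r : List Sym), Runs (whileBody (emit symbols))
      (mk ((enc w).code ++ m) [] [] [one] r) (st m (w.reverse ++ r)) (60 * w.length + 4) := by
    intro w
    induction w with
    | nil => exact fun m r => runs_whileBody_nil _ m r
    | cons x w ih =>
      intro m r
      rw [List.reverse_cons, List.append_assoc]
      refine (runs_whileBody_node (runs_emit_symbols x _ r) (ih m (x :: r))).mono ?_
      simp
      lia
  have h₁ := h w [] []
  simp only [List.append_nil] at h₁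
  have h₂ := runs_pour (k := .r) (k' := .b) (by simp) (mk [] [] [] [] w.reverse)
  simp only [mk_r, mk_b, List.reverse_reverse, List.append_nil, update_mk_r, update_mk_b,
    List.length_reverse] at h₂
  exact ((runs_while h₁).seq h₂).mono (by lia)

/-- Pushes the representation of the word on stack `a` to `main`. -/
def load : Prog :=
  .seq opNil (.seq (pour .a .r) (.loop .r fun x => .seq (pushData (enc x)) opCons))

theorem runs_load (w : List Sym) :
    Runs load (mk [] w [] [] []) (st (enc w).code []) (26 * w.length + 3) := by
  have h : ∀ (v w : List Sym), Runs (.loop .r fun x => .seq (pushData (enc x)) opCons)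
      (st (enc w).code v) (st (enc (v.reverse ++ w)).code []) (24 * v.length + 1) := by
    intro v
    induction v with
    | nil => exact fun w => .loop_nil _ rfl
    | cons x v ih =>
      intro w
      have h₁ := runs_pushData (enc x) (enc w).code v
      have h₂ := runs_cons (enc x) (enc w) [] v
      simp only [List.append_nil] at h₂
      have h₃ := ih (x :: w)
      have h₄ := wt_sym_le x
      rw [List.reverse_cons, List.append_assoc]
      refine (Runs.loop_cons (S := st (enc w).code (x :: v)) rfl ?_ h₃).mono
        (n := 1 + (2 * (enc x).size + 1 + (24 * v.length + 1))) ?_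
      · simpa [st] using h₁.seq h₂
      have h₅ := size_enc_le x
      simp
      lia
  have h₁ := Runs.push .main zero (mk [] w [] [] [])
  have h₂ := runs_pour (k := .a) (k' := .r) (by simp) (mk [zero] w [] [] [])
  have h₃ := h w.reverse []
  simp only [mk_r, mk_a, mk_main, List.append_nil, update_mk_r, update_mk_a, update_mk_main,
    List.length_reverse, List.reverse_reverse] at h₁ h₂ h₃
  exact (h₁.seq (h₂.seq h₃)).mono (by lia)

/-- A polynomial-time function is computed on words by a program. -/
theorem PT.exists_exec {α : Type} [Coded α] {word f : α → List Sym}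
    (hword : ∀ a, enc a = enc (word a)) (hf : PT f) :
    ∃ (p : Prog) (q : Polynomial ℕ), ∀ a, ∃ t ≤ q.eval (wt a),
      Exec p (fun k => if k = .a then word a else []) (fun k => if k = .b then f a else []) t := by
  obtain ⟨p, q, hp⟩ := hf
  -- The term `63 * q` pays for the run of `p` and for unloading, since the length of the output is
  -- below its weight and hence below `q`.
  refine ⟨.seq load (.seq p unload), 26 * Polynomial.X + 63 * q + 9, fun a => ?_⟩
  have h₁ := (hp a).2 [] []
  simp only [List.append_nil] at h₁
  have h₂ := runs_load (word a)
  rw [← hword] at h₂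
  have h₃ := h₂.seq (h₁.seq (runs_unload (f a)))
  have h₄ : (word a).length ≤ wt a := by
    have h₅ : (StackProgram.asList (enc (word a))).length ≤ (enc (word a)).size := by
      have : ∀ d : Data, (StackProgram.asList d).length ≤ d.size := by
        intro d
        induction d with
        | nil => simp
        | node x y _ ih => simp [Data.size]; lia
      exact this _
    rw [asList_enc, List.length_map, ← hword] at h₅
    exact h₅.trans (size_enc_le a)
  have h₅ := (length_lt_wt (f a)).trans_le (hp a).1
  obtain ⟨t, ht, h⟩ := h₃
  refine ⟨t, ht.trans ?_, ?_⟩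
  · simp
    lia
  · convert h using 1 <;> (funext k; cases k <;> rfl)

/-! ### Parsing -/

/-- Reads one symbol. The state consists of the word of bits or the value that is being read, and
the initial parts of the lists around it. -/
def parseStep (s : List (List Data)) (x : Sym) : List (List Data) :=
  if decide (x = .bra) then [] :: [] :: s
  else if decide (x = .comma) then
    [] :: (s.tail.headD [] ++ [enc (s.headD [])]) :: s.tail.tail
  -- Two empty words are discarded on well-formed input: the one begun after the last comma and the
  -- one that was current before the opening bracket.
  else if decide (x = .ket) then s.tail.headD [] :: s.tail.tail.tail
  else if decide (x = .blank) then s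
  else (s.headD [] ++ [enc (decide (x = .bit true))]) :: s.tail

def parse (w : List Sym) : Data := enc ((w.foldl parseStep [[]]).headD [])

/-- No step copies unboundedly much: a finished component moves into the surrounding list. The
growth is thus bounded by a constant, as `PT.foldl` requires. -/
theorem wt_parseStep_le (s : List (List Data)) (x : Sym) : wt (parseStep s x) ≤ wt s + 20 := by
  have h : ∀ s : List (List Data), wt (s.headD []) + wt s.tail ≤ wt s + 1 := by
    intro s
    cases s with
    | nil => simp
    | cons l s => simp; lia
  have h₁ := h s
  have h₂ := h s.tail
  have h₃ := h s.tail.tail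
  have h₄ := wt_append (s.headD []) [enc (decide (x = .bit true))]
  have h₅ := wt_append (s.tail.headD []) [enc (s.headD [])]
  have h₆ : wt (enc (s.headD [])) ≤ wt (s.headD []) := size_enc_le _
  have h₇ : wt (enc (decide (x = Computability.Γ'.bit true))) ≤ 3 := size_enc_le _
  simp only [wt_list_cons, wt_list_nil] at h₄ h₅
  unfold parseStep
  split_ifs <;> (try simp only [wt_list_cons, wt_list_nil]) <;> lia

theorem PT.parse : PT fun w => parse w := by
  refine .toData (.headD _ (.foldl (step := fun _ s x => parseStep s x) (init := fun _ => [[]])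
    (by fun_prop) (by fun_prop) ?_ 20 fun _ s x => by simpa using wt_parseStep_le s x))
  unfold parseStep
  refine .ite (by fun_prop) (by fun_prop) (.ite (by fun_prop) ?_ (.ite (by fun_prop) (by fun_prop)
    (.ite (by fun_prop) (by fun_prop) ?_)))
  · have h := PT.toData (f := fun p : List Sym × List (List Data) × Sym => p.2.1.headD [])
      (by fun_prop)
    fun_prop
  · have h := PT.toData (f := fun p : List Sym × List (List Data) × Sym =>
      decide (p.2.2 = Computability.Γ'.bit true)) (by fun_prop)
    fun_prop

/-- Reading the word `w` produces the datum `d`. -/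
def Parses (w : List Sym) (d : Data) : Prop :=
  ∃ l : List Data, enc l = d ∧ ∀ s, w.foldl parseStep ([] :: s) = l :: s

theorem Parses.parse {w : List Sym} {d : Data} (h : Parses w d) : parse w = d := by
  obtain ⟨l, rfl, h⟩ := h
  rw [StackProgram.parse, h, List.headD_cons]

theorem parses_bits (l : List Bool) : Parses (l.map Computability.Γ'.bit) (enc l) := by
  have h : ∀ (l : List Bool) (l' : List Data) s,
      (l.map Computability.Γ'.bit).foldl parseStep (l' :: s) = (l' ++ l.map enc) :: s := by
    intro l
    induction l with
    | nil => simp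
    | cons b l ih =>
      intro l' s
      rw [List.map_cons, List.foldl_cons, show parseStep (l' :: s) (.bit b) =
        (l' ++ [enc b]) :: s by simp [parseStep], ih]
      simp
  exact ⟨l.map enc, enc_map_enc l, fun s => by simpa using h l [] s⟩

open ConjQuery

theorem parses_bracket {ws : List (List Sym)} {ds : List Data} (h : List.Forall₂ Parses ws ds) :
    Parses (bracket ws) (enc ds) := by
  have h : ∀ (l : List Data) s, (ws.flatMap fun w => w ++ [Computability.Γ'.comma]).foldl parseStep
      ([] :: l :: s) = [] :: (l ++ ds) :: s := by
    induction h with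
    | nil => simp
    | @cons w d ws ds hw _ ih =>
      intro l s
      obtain ⟨l', rfl, hw⟩ := hw
      rw [List.flatMap_cons, List.foldl_append, List.foldl_append, hw, List.foldl_cons,
        List.foldl_nil, show parseStep (l' :: l :: s) .comma = [] :: (l ++ [enc l']) :: s by
          simp [parseStep], ih]
      simp
  refine ⟨ds, rfl, fun s => ?_⟩
  rw [bracket, List.foldl_cons, List.foldl_append, show parseStep ([] :: s) .bra =
    [] :: [] :: [] :: s by simp [parseStep], h]
  simp [parseStep]

theorem parses_list {α : Type} [Coded α] {e : α → List Sym} (he : ∀ a, Parses (e a) (enc a))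
    (l : List α) : Parses (bracket (l.map e)) (enc l) := by
  rw [← enc_map_enc]
  refine parses_bracket ?_
  induction l with
  | nil => exact .nil
  | cons a l ih => exact .cons (he a) ih

theorem parses_number (n : ℕ) : Parses (encodeNumber n) (enc n) := parses_bits _

theorem parses_nums (l : List ℕ) : Parses (encodeNums l) (enc l) := parses_list parses_number l

theorem parses_term (t : Term) : Parses (encodeTerm t) (enc t) := by
  have h := parses_bits t.bits
  cases t <;> exact h

theorem parses_terms (l : List Term) : Parses (encodeTerms l) (enc l) := parses_list parses_term l

theorem parses_fact (f : Fact) : Parses (encodeFact f) (enc f) :=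
  parses_bracket (.cons (parses_number _) (.cons (parses_nums _) .nil))

theorem parses_atom (A : Atom) : Parses (encodeAtom A) (enc A) :=
  parses_bracket (.cons (parses_number _) (.cons (parses_terms _) .nil))

theorem parses_atoms (l : List Atom) : Parses (encodeAtoms l) (enc l) := parses_list parses_atom l

/-- The data of a hypertree. -/
def hypertreeData (H : Hypertree) : List Data :=
  List.ofFn fun p : Fin (H.n + 1) =>
    enc [enc (H.parent p : ℕ), enc (H.chiList p), enc (H.lamList p)]

theorem parses_hypertree (H : Hypertree) : Parses (encodeHypertree H) (enc (hypertreeData H)) := by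
  refine parses_bracket (List.forall₂_iff_get.2 ⟨by simp [hypertreeData], fun i h₁ h₂ => ?_⟩)
  simp only [hypertreeData, List.get_ofFn]
  exact parses_bracket (.cons (parses_number _) (.cons (parses_nums _) (.cons (parses_atoms _)
    .nil)))

theorem parse_encodeInput (DB : Database) (Q : Query) (H : Hypertree) :
    parse (encodeInput DB Q H) = enc [enc [enc DB.facts, enc DB.dom], enc [enc Q.head, enc Q.body],
      enc (hypertreeData H)] :=
  Parses.parse (parses_bracket
    (.cons (parses_bracket (.cons (parses_list parses_fact _) (.cons (parses_nums _) .nil)))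
      (.cons (parses_bracket (.cons (parses_terms _) (.cons (parses_atoms _) .nil)))
        (.cons (parses_hypertree H) .nil))))

/-! ### Output -/

@[fun_prop]
theorem PT.encodeNumber : PT fun n : ℕ => encodeNumber n := by
  have h : PT fun n : ℕ => (StackProgram.asList (enc n)).map fun d : Data =>
      if decide (d = enc true) then Computability.Γ'.bit true else Computability.Γ'.bit false :=
    .map (.asList (.toData .identity)) (by fun_prop)
  refine h.congr fun n => ?_
  rw [show StackProgram.asList (enc n) = (Computability.encodeNat n).map enc from asList_enc _,
    ConjQuery.encodeNumber, List.map_map]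
  refine List.map_congr_left fun b _ => ?_
  cases b <;> rfl

@[fun_prop]
theorem PT.bracket : PT fun ws : List (List Sym) => bracket ws := by
  unfold ConjQuery.bracket
  exact .cons (by fun_prop) (.append (.flatMap (by fun_prop) (by fun_prop)) (by fun_prop))

@[fun_prop]
theorem PT.encodeNums : PT fun l : List ℕ => encodeNums l := by
  unfold ConjQuery.encodeNums
  exact PT.bracket.comp (.map (by fun_prop) (by fun_prop))

@[fun_prop]
theorem PT.encodeRelation : PT fun l : List (List ℕ) => encodeRelation l := by
  unfold ConjQuery.encodeRelation
  exact PT.bracket.comp (.map (by fun_prop) (by fun_prop))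

end StackProgram

/-! ### Inputs weighted by input size plus answer size -/

namespace ConjQuery

open StackProgram Coded

/-- The inputs to the evaluation problem for a fixed bound `k` on the width. -/
structure Input (k : ℕ) where
  S : Schema
  DB : Database
  Q : Query
  H : Hypertree
  db_isOver : DB.IsOver S
  query_isOver : Q.IsOver S
  isDecomposition : H.IsDecomposition Q
  width_le : H.width ≤ k

namespace Input

variable {k : ℕ} (I : Input k)

def word : List Sym := encodeInput I.DB I.Q I.H

def test : List (Term × ℕ) → Bool := satisfiable k I.DB.facts I.Q.body I.H.labels

def answers : List (List ℕ) := answerList I.test I.DB.dom I.Q.head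

theorem test_iff (σ : List (Term × ℕ)) :
    I.test σ ↔ ∃ θ, (∀ A ∈ I.Q.body, A.subst θ ∈ I.DB.facts) ∧ Solves θ σ := by
  constructor
  · refine exists_solves_of_satisfiable (fun A hA f hf h => ?_) I.isDecomposition I.width_le
    rw [(I.query_isOver A hA).2, (I.db_isOver f hf).2.1, h]
  · rintro ⟨θ, hθ, hσ⟩
    refine satisfiable_of_solves (fun v hv A hA => ?_) hθ hσ
    obtain ⟨p, rfl⟩ := List.mem_ofFn.1 hv
    have := (I.isDecomposition.isHypertree p).2 (show A ∈ I.H.lam p from List.mem_toFinset.2 hA)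
    simpa [Query.atoms] using this

theorem enumerates_answers : Enumerates I.answers (I.Q.answer I.DB) :=
  enumerates_answerList I.db_isOver I.test_iff

/-- The weight of an input is the sum of the sizes of the input and of the answer, the former up to
a constant factor. -/
instance : Coded (Input k) where
  enc I := enc I.word
  wt I := wt I.word + (encodeRelation I.answers).length
  size_enc_le I := (size_enc_le I.word).trans (Nat.le_add_right _ _)

theorem wt_le : wt I ≤ 12 * (I.word.length + (encodeRelation I.answers).length) + 1 := by
  have := wt_word_le I.word
  change wt I.word + (encodeRelation I.answers).length ≤ _
  lia

theorem length_answers_le : I.answers.length ≤ wt I := by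
  have h : ∀ ws : List (List Sym), ws.length ≤ (bracket ws).length := by
    intro ws
    -- Every tuple contributes at least its comma to the encoded relation.
    have : ws.length ≤ (ws.flatMap fun w => w ++ [Computability.Γ'.comma]).length := by
      rw [List.length_flatMap]
      refine le_trans (by simp) (List.card_nsmul_le_sum _ 1 ?_)
      simp
    simp only [bracket, List.length_cons, List.length_append]
    lia
  have h₁ := h (I.answers.map encodeNums)
  rw [List.length_map] at h₁
  exact h₁.trans (Nat.le_add_left _ _)

/-- An input is represented by its word. Parsing turns the word into a tree, from which the
components of the instance are read. -/
theorem pt_parse : PT fun I : Input k => enc [enc [enc I.DB.facts, enc I.DB.dom],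
    enc [enc I.Q.head, enc I.Q.body], enc (hypertreeData I.H)] := by
  have h : PT fun I : Input k => I.word :=
    PT.identity.congr_enc (fun _ => rfl) Polynomial.X fun I => by
      rw [Polynomial.eval_X]
      exact Nat.le_add_right _ _
  exact (PT.parse.comp h).congr fun I => (parse_encodeInput I.DB I.Q I.H).symm

@[fun_prop]
theorem pt_facts : PT fun I : Input k => I.DB.facts :=
  .of_enc ((PT.component 0).comp ((PT.component 0).comp pt_parse)) fun _ => rfl

@[fun_prop]
theorem pt_dom : PT fun I : Input k => I.DB.dom :=
  .of_enc ((PT.component 1).comp ((PT.component 0).comp pt_parse)) fun _ => rfl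

@[fun_prop]
theorem pt_head : PT fun I : Input k => I.Q.head :=
  .of_enc ((PT.component 0).comp ((PT.component 1).comp pt_parse)) fun _ => rfl

@[fun_prop]
theorem pt_body : PT fun I : Input k => I.Q.body :=
  .of_enc ((PT.component 1).comp ((PT.component 1).comp pt_parse)) fun _ => rfl

@[fun_prop]
theorem pt_labels : PT fun I : Input k => I.H.labels := by
  have h₁ : PT fun I : Input k => hypertreeData I.H :=
    .of_enc ((PT.component 2).comp pt_parse) fun _ => rfl
  have h₂ : PT fun I : Input k => (hypertreeData I.H).map fun d =>
      Data.node (component 1 d) (component 2 d) :=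
    .map h₁ (by fun_prop)
  refine .of_enc h₂.toData fun I => ?_
  rw [← enc_map_enc]
  congr 1
  simp only [Hypertree.labels, hypertreeData, List.map_ofFn]
  rfl

theorem pt_test : PT fun p : Input k × List (Term × ℕ) => p.1.test p.2 :=
  .satisfiable k (pt_facts.comp .fst) (pt_body.comp .fst) (pt_labels.comp .fst) .snd

theorem wt_le_of_forall_mem {α : Type} [Coded α] {l : List α} {B : ℕ} (h : ∀ x ∈ l, wt x ≤ B) :
    wt l ≤ l.length * (B + 1) + 1 := by
  induction l with
  | nil => simp
  | cons x l ih =>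
    have h₁ := ih fun y hy => h y (List.mem_cons_of_mem _ hy)
    have h₂ := h x (by simp)
    simp only [wt_list_cons, List.length_cons, add_mul, one_mul] at h₁ ⊢
    lia

theorem wt_subst_le {t : Term} {θ : ℕ → ℕ} {dom : List ℕ}
    (h : ∀ x, t = .var x → θ x ∈ dom) : wt (t.subst θ) ≤ wt t + wt dom := by
  cases t with
  | var x => exact (wt_le_of_mem (h x rfl)).trans (Nat.le_add_left _ _)
  | const c =>
    refine le_trans ?_ (Nat.le_add_right _ _)
    change (enc (Computability.encodeNat c)).size ≤
      (enc true).size + (enc (Computability.encodeNat c)).size + 1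
    lia

/-- The number of assignments is at most that of the answers plus one, and each consists of at most
as many pairs as the head has terms, with values from the head or the universe. -/
theorem wt_evaluations_le {us ts : List Term} (h : I.Q.head = us ++ ts) :
    wt (evaluations I.test I.DB.dom ts) ≤ (wt I + 1) *
      (wt I.Q.head * (2 * wt I.Q.head + wt I.DB.dom + 2) + 2) + 1 := by
  have hlen : (evaluations I.test I.DB.dom ts).length ≤ wt I + 1 := by
    have h₁ := length_evaluations_le I.db_isOver I.test_iff us ts
    rw [← h] at h₁
    have h₂ := I.length_answers_le
    simp only [answers, answerList, List.length_map] at h₂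
    lia
  have hts : ts.length ≤ wt I.Q.head := by
    have := length_lt_wt I.Q.head
    rw [h, List.length_append, ← h] at this
    lia
  have hmem : ∀ σ ∈ evaluations I.test I.DB.dom ts,
      wt σ ≤ wt I.Q.head * (2 * wt I.Q.head + wt I.DB.dom + 2) + 1 := by
    intro σ hσ
    obtain ⟨θ, -, hd, rfl⟩ := (mem_evaluations I.test_iff).1 hσ
    refine (wt_le_of_forall_mem (B := 2 * wt I.Q.head + wt I.DB.dom + 1) fun p hp => ?_).trans ?_
    · obtain ⟨t, ht, rfl⟩ := List.mem_map.1 hp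
      have h₁ : wt t ≤ wt I.Q.head := wt_le_of_mem (by rw [h]; exact List.mem_append_right _ ht)
      have h₂ := wt_subst_le (t := t) (θ := θ) (dom := I.DB.dom) fun x hx =>
        hd x (show Term.var x ∈ ts from hx ▸ ht)
      simp only [wt_prod]
      lia
    · rw [List.length_map]
      exact Nat.add_le_add_right (Nat.mul_le_mul_right _ hts) 1
  refine (wt_le_of_forall_mem hmem).trans ?_
  exact Nat.add_le_add_right (Nat.mul_le_mul_right _ hlen) 1

theorem pt_answers : PT fun I : Input k => I.answers := by
  obtain ⟨_, q₁, h₁⟩ := pt_head (k := k)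
  obtain ⟨_, q₂, h₂⟩ := pt_dom (k := k)
  refine .answerList pt_test (by fun_prop) (by fun_prop)
    ((Polynomial.X + 1) * (q₁ * (2 * q₁ + q₂ + 2) + 2) + 1) fun I us vs h => ?_
  refine (I.wt_evaluations_le h).trans ?_
  have h₃ := (h₁ I).1
  have h₄ := (h₂ I).1
  simp only [Polynomial.eval_add, Polynomial.eval_mul, Polynomial.eval_X, Polynomial.eval_one,
    Polynomial.eval_ofNat]
  gcongr

end Input

end ConjQuery

theorem mainTheorem7 (k : ℕ) (hk : 0 < k) :
    ∃ (M : Turing.TM2ComputableAux Computability.Γ' Computability.Γ') (time : Polynomial ℕ),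
      (∀ s : M.tm.K, Finite (M.tm.Γ s)) ∧
      ∀ (S : ConjQuery.Schema) (DB : ConjQuery.Database) (Q : ConjQuery.Query)
        (H : ConjQuery.Hypertree),
        DB.IsOver S → Q.IsOver S → H.IsDecomposition Q → H.width ≤ k →
        ∃ L : List (List ℕ), ConjQuery.Enumerates L (Q.answer DB) ∧
          Nonempty (Turing.TM2OutputsInTime M.tm
            ((ConjQuery.encodeInput DB Q H).map M.inputAlphabet.symm)
            (some ((ConjQuery.encodeRelation L).map M.outputAlphabet.symm))
            (time.eval ((ConjQuery.encodeInput DB Q H).length +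
              (ConjQuery.encodeRelation L).length))) := by
  obtain ⟨p, q, hp⟩ := StackProgram.PT.exists_exec (word := ConjQuery.Input.word (k := k))
    (fun _ => rfl) (StackProgram.PT.encodeRelation.comp ConjQuery.Input.pt_answers)
  -- The inner polynomial is the bound `Input.wt_le` of the weight in terms of N + S; the final 1 is
  -- the halting step.
  refine ⟨⟨p.toFinTM2, Equiv.refl _, Equiv.refl _⟩, q.comp (12 * Polynomial.X + 1) + 1,
    fun _ => inferInstanceAs (Finite Computability.Γ'), fun S DB Q H hDB hQ hH hw => ?_⟩
  let I : ConjQuery.Input k := ⟨S, DB, Q, H, hDB, hQ, hH, hw⟩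
  refine ⟨I.answers, I.enumerates_answers, ?_⟩
  obtain ⟨t, ht, h⟩ := hp I
  have h₁ := StackProgram.eval_mono q I.wt_le
  let outputs (x y : List Computability.Γ') : Prop :=
    Nonempty (Turing.TM2OutputsInTime p.toFinTM2 x (some y)
      ((q.comp (12 * Polynomial.X + 1) + 1).eval
        ((ConjQuery.encodeInput DB Q H).length + (ConjQuery.encodeRelation I.answers).length)))
  have h₂ : outputs (ConjQuery.encodeInput DB Q H) (ConjQuery.encodeRelation I.answers) := by
    refine h.outputsInTime ?_
    simp only [Polynomial.eval_add, Polynomial.eval_comp, Polynomial.eval_mul, Polynomial.eval_X,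
      Polynomial.eval_one, Polynomial.eval_ofNat]
    exact Nat.add_le_add_right (ht.trans h₁) 1
  have h₃ : outputs ((ConjQuery.encodeInput DB Q H).map (Equiv.refl Computability.Γ').symm)
      ((ConjQuery.encodeRelation I.answers).map (Equiv.refl Computability.Γ').symm) := by
    rw [show ⇑(Equiv.refl Computability.Γ').symm = id from rfl, List.map_id, List.map_id]
    exact h₂
  exact h₃
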